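/- **Notation.** Let $p$ be an odd prime, $\Gamma_0(p)=\{\left(\begin{smallmatrix}a&b\\c&d\end{smallmatrix}\right)\in\mathrm{SL}_2(\mathbb Z): p\mid c\}$, and let $\Gamma_0^+(p)$ be the normalizer of $\Gamma_0(p)$ in $\mathrm{SL}_2(\mathbb R)$. Put $\operatorname{sgn}(0)=0$. For $\gamma=\left(\begin{smallmatrix}a&b\\c&d\end{smallmatrix}\right)\in\mathrm{SL}_2(\mathbb Z)$ the Rademacher symbol is $$\Phi(\gamma)=\begin{cases} b/d & c=0,\\ \frac{a+d}{c}-12\operatorname{sgn}(c)\,s(d,|c|) & c\ne0,\end{cases}$$ where $s(h,k)=\sum_{\mu=1}^{k}((h\mu/k))((\mu/k))$, with $((x))=x-\lfloor x\rfloor-\frac12$ for $x\notin\mathbb Z$ and $((x))=0$ for $x\in\mathbb Z$. The Rademacher symbol $\Phi_p$ of $\Gamma_0^+(p)$ is defined for $\gamma=\left(\begin{smallmatrix}a&b\\c&d\end{smallmatrix}\right)$ by $$\Phi_p(\gamma)=\begin{cases}\frac12\Big[\Phi(\gamma)+\Phi\left(\begin{smallmatrix}a&pb\\c/p&d\end{smallmatrix}\right)\Big]&\gamma\in\Gamma_0(p),\\[4pt]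 \Phi_p\Big(\frac1{\sqrt p}\left(\begin{smallmatrix}c&d\\-pa&-pb\end{smallmatrix}\right)\Big)-3\operatorname{sgn}(-ac)&\gamma\in\Gamma_0^+(p)\setminus\Gamma_0(p).\end{cases}$$ Let $K$ be the Farey triangulation of the upper half-plane: its vertices are $\mathbb Q\cup\{\infty\}$ (with $\infty=\frac10$), two vertices $\frac{n_1}{d_1},\frac{n_2}{d_2}$ in lowest terms being joined by an edge if and only if $n_1d_2-n_2d_1=\pm1$. A based edge path $\alpha=(a_1,\dots,a_k)$, $k\ge 0$, is a path of $k+1$ directed edges of $K$ whose first edge goes from $\infty$ to $0$, where $a_j\in\mathbb Z$ is the number of triangles of $K$ turned through about the common vertex of the $j$-th and the $(j+1)$-st edge, counted positively to the left (counterclockwise about that vertex) and negatively to the right. It is made from $\left(\begin{smallmatrix}a&b\\c&d\end{smallmatrix}\right)\in\mathrm{SL}_2(\mathbb Z)$ if its last edge goes from $b/d$ to $a/c$. Let $M_\alpha$ be the symmetric $k\times k$ matrix with diagonal entries $a_1,\dots,a_k$, entries $1$ at the places $(i,j)$ with $|i-j|=1$, and $0$ elsewhere; $\tau_\alpha$ and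 $\sigma_\alpha$ denote its trace and its signature. **Theorem.** Let $\gamma=\left(\begin{smallmatrix}a&b\\c&d\end{smallmatrix}\right)\in\Gamma_0^+(p)$. 1. If $\gamma\in\Gamma_0(p)$, then there are based edge paths in $K$ made from $\gamma$ and from $\left(\begin{smallmatrix}a&pb\\c/p&d\end{smallmatrix}\right)\in\mathrm{SL}_2(\mathbb Z)$, and for every based edge path $\alpha$ made from the former matrix and every based edge path $\beta$ made from the latter, $$\Phi_p(\gamma)=\frac{\tau_\alpha+\tau_\beta}2-3\left(\frac{\sigma_\alpha+\sigma_\beta}2\right).$$ 2. If $\gamma\notin\Gamma_0(p)$, then $\frac1{\sqrt p}\left(\begin{smallmatrix}c&d\\-pa&-pb\end{smallmatrix}\right)\in\Gamma_0(p)$ and $$\Phi_p(\gamma)=\Phi_p\left(\tfrac1{\sqrt p}\left(\begin{smallmatrix}c&d\\-pa&-pb\end{smallmatrix}\right)\right)-3\operatorname{sgn}(-ac).$$ -/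

import Mathlib

open scoped MatrixGroups

noncomputable section

namespace FareyRademacher

/-! ### Dedekind sums and the Rademacher symbol of `SL(2, ℤ)` -/

/-- The sawtooth function `((x))`. -/
def sawtooth (x : ℚ) : ℚ :=
  if x = (⌊x⌋ : ℚ) then 0 else x - ⌊x⌋ - 1 / 2

/-- The Dedekind sum `s(h, k) = ∑_{μ = 1}^{k} ((hμ/k)) ((μ/k))`. -/
def dedekindSum (h : ℤ) (k : ℕ) : ℚ :=
  ∑ μ ∈ Finset.Icc 1 k, sawtooth ((h : ℚ) * μ / k) * sawtooth ((μ : ℚ) / k)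

/-- The Rademacher symbol `Φ` on `SL(2, ℤ)`. -/
def rademacher (γ : SL(2, ℤ)) : ℚ :=
  if γ 1 0 = 0 then (γ 0 1 : ℚ) / (γ 1 1 : ℚ)
  else ((γ 0 0 : ℚ) + (γ 1 1 : ℚ)) / (γ 1 0 : ℚ)
    - 12 * ((γ 1 0).sign : ℚ) * dedekindSum (γ 1 1) (γ 1 0).natAbs

/-! ### The groups `Γ₀(p)` and `Γ₀⁺(p)` inside `SL(2, ℝ)` -/

/-- The inclusion `SL(2, ℤ) → SL(2, ℝ)`. -/
def toReal : SL(2, ℤ) →* SL(2, ℝ) :=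
  Matrix.SpecialLinearGroup.map (Int.castRingHom ℝ)

/-- `Γ₀(p)` as a subgroup of `SL(2, ℝ)`. -/
def gamma0Real (p : ℕ) : Subgroup SL(2, ℝ) :=
  (CongruenceSubgroup.Gamma0 p).map toReal

/-- `Γ₀⁺(p)`: the normalizer of `Γ₀(p)` in `SL(2, ℝ)`. -/
def gamma0Plus (p : ℕ) : Subgroup SL(2, ℝ) :=
  Subgroup.normalizer (gamma0Real p : Set SL(2, ℝ))

/-- For `γ = (a, b; c, d)` in `Γ₀(p)`, the matrix `(a, pb; c/p, d)` of `SL(2, ℤ)`. -/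
def conjMul (p : ℕ) (γ : CongruenceSubgroup.Gamma0 p) : SL(2, ℤ) :=
  ⟨!![γ.1 0 0, (p : ℤ) * γ.1 0 1; γ.1 1 0 / (p : ℤ), γ.1 1 1], by
    have hdvd : (p : ℤ) ∣ γ.1 1 0 :=
      (ZMod.intCast_zmod_eq_zero_iff_dvd _ p).1 (CongruenceSubgroup.Gamma0_mem.1 γ.2)
    have hdet : γ.1 0 0 * γ.1 1 1 - γ.1 0 1 * γ.1 1 0 = 1 := by
      have h := γ.1.2
      rwa [Matrix.det_fin_two] at h
    have hc : (p : ℤ) * (γ.1 1 0 / (p : ℤ)) = γ.1 1 0 := Int.mul_ediv_cancel' hdvd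
    rw [Matrix.det_fin_two_of]
    calc _ = γ.1 0 0 * γ.1 1 1 - γ.1 0 1 * ((p : ℤ) * (γ.1 1 0 / (p : ℤ))) := by ring
      _ = 1 := by rw [hc, hdet]⟩

/-- For `γ = (a, b; c, d)`, the matrix `(1/√p) (c, d; -pa, -pb) = W_p⁻¹ γ`, where
`W_p = (1/√p) (0, -1; p, 0)` is the Fricke involution. -/
def frickeTwist (p : ℕ) [NeZero p] (γ : SL(2, ℝ)) : SL(2, ℝ) :=
  ⟨(1 / √(p : ℝ)) • !![γ 1 0, γ 1 1; -((p : ℝ) * γ 0 0), -((p : ℝ) * γ 0 1)], by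
    have hp : (p : ℝ) ≠ 0 := Nat.cast_ne_zero.2 (NeZero.ne p)
    have hdet : γ 0 0 * γ 1 1 - γ 0 1 * γ 1 0 = 1 := by
      have h := γ.2
      rwa [Matrix.det_fin_two] at h
    have hs : (1 / √(p : ℝ)) ^ 2 = 1 / (p : ℝ) := by
      rw [div_pow, Real.sq_sqrt (Nat.cast_nonneg p), one_pow]
    rw [Matrix.det_smul, Matrix.det_fin_two_of, Fintype.card_fin, hs]
    calc _ = 1 / (p : ℝ) * (p : ℝ) * (γ 0 0 * γ 1 1 - γ 0 1 * γ 1 0) := by ring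
      _ = 1 := by rw [hdet, one_div_mul_cancel hp, one_mul]⟩

/-! ### The Rademacher symbol of `Γ₀⁺(p)` -/

/-- `½ [Φ(γ) + Φ(a, pb; c/p, d)]` for `γ = (a, b; c, d)` in `Γ₀(p)`. -/
def rademacherAvg (p : ℕ) (γ : CongruenceSubgroup.Gamma0 p) : ℚ :=
  1 / 2 * (rademacher γ.1 + rademacher (conjMul p γ))

open scoped Classical in
/-- The Rademacher symbol `Φ_p`, meant for elements `γ = (a, b; c, d)` of `Γ₀⁺(p)`: it is the
average above if `γ ∈ Γ₀(p)`, and `Φ_p(W_p⁻¹ γ) - 3 sgn(-ac)` otherwise, `W_p⁻¹ γ` then being in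
`Γ₀(p)`. The last branch is never taken on `Γ₀⁺(p)`. -/
def rademacherP (p : ℕ) [NeZero p] (γ : SL(2, ℝ)) : ℚ :=
  if h : ∃ g : CongruenceSubgroup.Gamma0 p, toReal g.1 = γ then rademacherAvg p h.choose
  else if h : ∃ g : CongruenceSubgroup.Gamma0 p, toReal g.1 = frickeTwist p γ then
    rademacherAvg p h.choose - 3 * ((SignType.sign (-(γ 0 0 * γ 1 0)) : ℤ) : ℚ)
  else 0

/-! ### The triangulation `K` and its based edge paths -/

/-- Numerator of a vertex of `K` in lowest terms, where `∞ = 1/0`. -/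
def num (v : OnePoint ℚ) : ℤ := v.elim 1 (fun q => q.num)

/-- Denominator of a vertex of `K` in lowest terms, where `∞ = 1/0`. -/
def den (v : OnePoint ℚ) : ℤ := v.elim 0 (fun q => (q.den : ℤ))

/-- The point `n/d` of `ℚ ∪ {∞}`, with `n/0 = ∞`. -/
def frac (n d : ℤ) : OnePoint ℚ :=
  if d = 0 then OnePoint.infty else (((n : ℚ) / (d : ℚ) : ℚ) : OnePoint ℚ)

/-- The determinant `n₁ d₂ - n₂ d₁` of two vertices `n₁/d₁` and `n₂/d₂`. -/
def vdet (u v : OnePoint ℚ) : ℤ := num u * den v - num v * den u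

/-- The edges of `K`: two vertices are joined iff their determinant is `±1`. -/
def farey : SimpleGraph (OnePoint ℚ) where
  Adj u v := vdet u v = 1 ∨ vdet u v = -1
  symm := ⟨fun u v h => by
    unfold vdet at *
    omega⟩
  loopless := ⟨fun u h => by simp [vdet] at h⟩

/-- `u, v, w` span a triangle of `K` and are its vertices in counterclockwise order, as for
`∞, 0, 1` (the product of determinants does not depend on the signs chosen for the fractions). -/
def CcwTriangle (u v w : OnePoint ℚ) : Prop :=
  farey.Adj u v ∧ farey.Adj v w ∧ farey.Adj w u ∧ 0 < vdet u v * vdet v w * vdet w u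

/-- `Turn v u w n`: swinging about the common vertex `v`, one gets from the edge between `v` and
`u` to the edge between `v` and `w` through a net number of `n` triangles of `K`, a triangle
counting `+1` when crossed to the left (counterclockwise about `v`) and `-1` when crossed to the
right (clockwise). -/
inductive Turn (v u : OnePoint ℚ) : OnePoint ℚ → ℤ → Prop
  | refl (h : farey.Adj v u) : Turn v u u 0
  | left {w w' : OnePoint ℚ} {n : ℤ} (h : Turn v u w n) (ht : CcwTriangle v w w') :
      Turn v u w' (n + 1)
  | right {w w' : OnePoint ℚ} {n : ℤ} (h : Turn v u w n) (ht : CcwTriangle v w' w) :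
      Turn v u w' (n - 1)

/-- A based (directed) edge path `(a₁, …, a_k)` in `K`: the successive vertices, starting with the
edge from `∞` to `0`, together with the numbers `a_j` of triangles turned through at the common
vertex of two consecutive edges. -/
structure BasedEdgePath where
  /-- the number of turns -/
  k : ℕ
  /-- the successive endpoints of the `k + 1` edges -/
  vertex : Fin (k + 2) → OnePoint ℚ
  start_infty : vertex 0 = OnePoint.infty
  start_zero : vertex 1 = ((0 : ℚ) : OnePoint ℚ)
  adj : ∀ i : Fin (k + 1), farey.Adj (vertex i.castSucc) (vertex i.succ)
  /-- the integers `a₁, …, a_k` -/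
  turn : Fin k → ℤ
  turn_spec : ∀ j : Fin k,
    Turn (vertex j.castSucc.succ) (vertex j.castSucc.castSucc) (vertex j.succ.succ) (turn j)

namespace BasedEdgePath

/-- The path is made from `(a, b; c, d)`: its final directed edge goes from `b/d` to `a/c`. -/
def MadeFrom (α : BasedEdgePath) (A : SL(2, ℤ)) : Prop :=
  α.vertex (Fin.last α.k).castSucc = frac (A 0 1) (A 1 1) ∧
    α.vertex (Fin.last (α.k + 1)) = frac (A 0 0) (A 1 0)

/-- The tridiagonal matrix `M_α`: diagonal entries `a₁, …, a_k`, entries `1` next to the diagonal,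
and `0` elsewhere. -/
def mat (α : BasedEdgePath) : Matrix (Fin α.k) (Fin α.k) ℤ :=
  Matrix.of fun i j =>
    if i = j then α.turn i
    else if (i : ℕ) + 1 = (j : ℕ) ∨ (j : ℕ) + 1 = (i : ℕ) then 1 else 0

/-- The trace `τ_α` of `M_α`. -/
def trace (α : BasedEdgePath) : ℤ := α.mat.trace

/-- The signature `σ_α` of `M_α` as a real symmetric matrix. -/
def signature (α : BasedEdgePath) : ℤ :=
  (sigPos (α.mat.map (Int.cast : ℤ → ℝ)).toQuadraticForm' : ℤ)
    - (sigNeg (α.mat.map (Int.cast : ℤ → ℝ)).toQuadraticForm' : ℤ)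

end BasedEdgePath

end FareyRademacher

end

open FareyRademacher

noncomputable section

namespace FareyRademacher

/-! ### Dedekind sums -/

/-! The first statement is proved for `rademacher` on one matrix of `SL(2, ℤ)`; averaging over `γ`
and `conjMul p γ` gives the formula for `rademacherP`. Turning through `n` triangles about a vertex
is right multiplication by `T ^ n` (`turn_frac_iff`), so a path with turns `a₁, …, a_k` ends at the
edge of the word `S T^{a₁} S ⋯ T^{a_k} S`, and the last edge determines this matrix up to sign.
Right multiplication by `T ^ n` adds `n` to `Φ`, and right multiplication by `S` subtracts `3
sgn(cd)`, which is Dedekind reciprocity (`rademacher_mul_S`). Along the word the additions give the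
trace of `M_α`, and the signs are those of products of successive lower left entries. These entries
satisfy the three-term recurrence of the leading principal minors of `M_α`, so by Jacobi's signature
rule, valid for tridiagonal matrices even when minors vanish (`sig_tridiag`), the signs sum to the
signature. Paths exist because `S` and `T` generate.

The second statement rests on the normalizer being `Γ₀(p) ∪ W_p Γ₀(p)`. Conjugating a few elements
of `Γ₀(p)` shows that a normalizing matrix is proportional to a primitive integral one, whose
determinant can only be `1` or `p` (`det_eq_one_or_prime`). -/

lemma sawtooth_of_fract_eq_zero {x : ℚ} (h : Int.fract x = 0) : sawtooth x = 0 := by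
  rw [sawtooth, if_pos]
  have := Int.self_sub_floor x
  linarith

lemma sawtooth_of_fract_ne_zero {x : ℚ} (h : Int.fract x ≠ 0) :
    sawtooth x = Int.fract x - 1 / 2 := by
  rw [sawtooth, if_neg, Int.self_sub_floor]
  intro hx
  exact h (by rw [← Int.self_sub_floor]; linarith)

lemma sawtooth_add_intCast (x : ℚ) (n : ℤ) : sawtooth (x + n) = sawtooth x := by
  by_cases h : Int.fract x = 0
  · rw [sawtooth_of_fract_eq_zero h, sawtooth_of_fract_eq_zero (by rwa [Int.fract_add_intCast])]
  · rw [sawtooth_of_fract_ne_zero h, sawtooth_of_fract_ne_zero (by rwa [Int.fract_add_intCast]),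
      Int.fract_add_intCast]

lemma sawtooth_neg (x : ℚ) : sawtooth (-x) = -sawtooth x := by
  by_cases h : Int.fract x = 0
  · rw [sawtooth_of_fract_eq_zero h, sawtooth_of_fract_eq_zero (Int.fract_neg_eq_zero.2 h),
      neg_zero]
  · rw [sawtooth_of_fract_ne_zero h,
      sawtooth_of_fract_ne_zero (fun h' => h (Int.fract_neg_eq_zero.1 h')), Int.fract_neg h]
    ring

lemma dedekindSum_neg (h : ℤ) (k : ℕ) : dedekindSum (-h) k = -dedekindSum h k := by
  simp only [dedekindSum, ← Finset.sum_neg_distrib]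
  refine Finset.sum_congr rfl fun μ _ => ?_
  rw [← neg_mul, ← sawtooth_neg]
  push_cast
  ring_nf

lemma dedekindSum_add_mul (h n : ℤ) (k : ℕ) :
    dedekindSum (h + n * k) k = dedekindSum h k := by
  refine Finset.sum_congr rfl fun μ hμ => ?_
  have hk : (k : ℚ) ≠ 0 := by
    have := Finset.mem_Icc.1 hμ
    exact_mod_cast (by omega : k ≠ 0)
  have : (((h + n * k : ℤ) : ℚ) * μ / k) = (h : ℚ) * μ / k + ((n * μ : ℤ) : ℚ) := by
    push_cast
    field_simp
  rw [this, sawtooth_add_intCast]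

lemma fract_natCast_div (n k : ℕ) (hk : 0 < k) :
    Int.fract ((n : ℚ) / k) = ((n % k : ℕ) : ℚ) / k := by
  have hk' : (k : ℚ) ≠ 0 := by exact_mod_cast hk.ne'
  rw [Int.fract_eq_iff]
  refine ⟨by positivity, ?_, ((n / k : ℕ) : ℤ), ?_⟩
  · rw [div_lt_one (by positivity)]
    exact_mod_cast Nat.mod_lt n hk
  · have h : (n : ℚ) = k * (n / k : ℕ) + (n % k : ℕ) := by exact_mod_cast (Nat.div_add_mod n k).symm
    rw [Int.cast_natCast, ← sub_div, div_eq_iff hk']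
    linarith

lemma sum_range_natCast (k : ℕ) : ∑ μ ∈ Finset.range k, (μ : ℚ) = k * (k - 1) / 2 := by
  induction k with
  | zero => simp
  | succ k ih => rw [Finset.sum_range_succ, ih]; push_cast; ring

lemma sum_range_natCast_sq (k : ℕ) :
    ∑ μ ∈ Finset.range k, (μ : ℚ) ^ 2 = (k - 1) * k * (2 * k - 1) / 6 := by
  induction k with
  | zero => simp
  | succ k ih => rw [Finset.sum_range_succ, ih]; push_cast; ring

/-- Multiplication by a unit permutes the residues. -/
lemma sum_range_mul_mod {M : Type*} [AddCommMonoid M] {h k : ℕ} (hk : 0 < k)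
    (hc : Nat.Coprime h k) (F : ℕ → M) :
    ∑ μ ∈ Finset.range k, F (h * μ % k) = ∑ μ ∈ Finset.range k, F μ := by
  have hmaps : ∀ μ ∈ Finset.range k, h * μ % k ∈ Finset.range k := fun μ _ =>
    Finset.mem_range.2 (Nat.mod_lt _ hk)
  have hinj : Set.InjOn (fun μ => h * μ % k) (Finset.range k : Set ℕ) := by
    intro x hx y hy hxy
    have h1 : x ≡ y [MOD k] := Nat.ModEq.cancel_left_of_coprime (by rwa [Nat.gcd_comm]) hxy
    rw [Finset.coe_range, Set.mem_Iio] at hx hy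
    exact h1.eq_of_lt_of_lt hx hy
  have himg : (Finset.range k).image (fun μ => h * μ % k) = Finset.range k :=
    Finset.eq_of_subset_of_card_le (Finset.image_subset_iff.2 hmaps)
      (by rw [Finset.card_image_of_injOn hinj])
  conv_rhs => rw [← himg]
  rw [Finset.sum_image hinj]

/-- Away from integers the sawtooth is the fractional part minus `1/2`. By coprimality this fails
only at `μ = 0`, where the product of sawtooths is `0` but the naive formula gives `1/4`. -/
lemma dedekindSum_eq_sum_mod {h k : ℕ} (hk : 0 < k) (hc : Nat.Coprime h k) :
    dedekindSum h k =
      (∑ μ ∈ Finset.range k, ((h * μ % k : ℕ) : ℚ) * μ) / k ^ 2 - ((k : ℚ) - 1) / 4 := by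
  have hk' : (k : ℚ) ≠ 0 := by exact_mod_cast hk.ne'
  have hterm : ∀ μ ∈ Finset.range k, sawtooth (((h : ℤ) : ℚ) * μ / k) * sawtooth ((μ : ℚ) / k)
      = (((h * μ % k : ℕ) : ℚ) / k - 1 / 2) * ((μ : ℚ) / k - 1 / 2)
        - if μ = 0 then 1 / 4 else 0 := by
    intro μ hμ
    rw [Finset.mem_range] at hμ
    have h1 : ((h : ℤ) : ℚ) * μ / k = ((h * μ : ℕ) : ℚ) / k := by push_cast; rfl
    rw [h1]
    have f1 := fract_natCast_div (h * μ) k hk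
    have f2 := fract_natCast_div μ k hk
    rw [Nat.mod_eq_of_lt hμ] at f2
    rcases Nat.eq_zero_or_pos μ with rfl | h0
    · rw [sawtooth_of_fract_eq_zero (x := ((0 : ℕ) : ℚ) / k) (by simp)]
      norm_num
    · have h2 : h * μ % k ≠ 0 := fun h3 => by
        have := Nat.le_of_dvd h0 (hc.symm.dvd_of_dvd_mul_left (Nat.dvd_of_mod_eq_zero h3))
        omega
      rw [sawtooth_of_fract_ne_zero, sawtooth_of_fract_ne_zero, f1, f2, if_neg h0.ne', sub_zero]
      · rw [f2]; positivity
      · rw [f1]; exact div_ne_zero (by exact_mod_cast h2) hk'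
  have hIcc : dedekindSum h k = ∑ μ ∈ Finset.range k,
      sawtooth (((h : ℤ) : ℚ) * μ / k) * sawtooth ((μ : ℚ) / k) := by
    rw [dedekindSum, ← Finset.sum_subset (s₁ := Finset.Icc 1 (k - 1))]
    · apply Finset.sum_subset
      · intro x hx
        simp only [Finset.mem_Icc, Finset.mem_range] at *
        omega
      · intro x hx hx'
        simp only [Finset.mem_Icc, Finset.mem_range] at *
        have : x = 0 := by omega
        subst this
        rw [sawtooth_of_fract_eq_zero (x := ((0 : ℕ) : ℚ) / k) (by simp), mul_zero]
    · intro x hx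
      simp only [Finset.mem_Icc] at *
      omega
    · intro x hx hx'
      simp only [Finset.mem_Icc] at *
      have : x = k := by omega
      subst this
      rw [sawtooth_of_fract_eq_zero (x := (x : ℚ) / x) (by rw [div_self hk']; simp), mul_zero]
  rw [hIcc, Finset.sum_congr rfl hterm, Finset.sum_sub_distrib, Finset.sum_ite_eq',
    if_pos (Finset.mem_range.2 hk)]
  have hexp : ∀ μ : ℕ, (((h * μ % k : ℕ) : ℚ) / k - 1 / 2) * ((μ : ℚ) / k - 1 / 2)
      = ((h * μ % k : ℕ) : ℚ) * μ / k ^ 2 - ((h * μ % k : ℕ) : ℚ) / (2 * k)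
        - (μ : ℚ) / (2 * k) + 1 / 4 := by
    intro μ; field_simp; ring
  simp only [hexp, Finset.sum_add_distrib, Finset.sum_sub_distrib, ← Finset.sum_div]
  rw [sum_range_mul_mod hk hc (fun μ => (μ : ℚ)), sum_range_natCast, Finset.sum_const,
    Finset.card_range, nsmul_eq_mul]
  field_simp
  ring

/-- Lattice points below a line, weighted by height, counted by columns and by rows. -/
lemma sum_div_mul_div_succ {h k : ℕ} (hh : 0 < h) (hk : 0 < k) (hc : Nat.Coprime h k) :
    ∑ μ ∈ Finset.range k, ((h * μ / k : ℕ) : ℚ) * ((h * μ / k : ℕ) + 1) =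
      ∑ ν ∈ Finset.range h, 2 * (ν : ℚ) * ((k : ℚ) - 1 - (k * ν / h : ℕ)) := by
  have hcol : ∀ μ ∈ Finset.range k, ((h * μ / k : ℕ) : ℚ) * ((h * μ / k : ℕ) + 1) =
      ∑ ν ∈ Finset.range h, if k * ν ≤ h * μ then 2 * (ν : ℚ) else 0 := by
    intro μ hμ
    rw [Finset.mem_range] at hμ
    have hlt : h * μ / k < h := by
      rw [Nat.div_lt_iff_lt_mul hk]
      exact Nat.mul_lt_mul_of_pos_left hμ hh
    rw [← Finset.sum_filter]
    have : (Finset.range h).filter (fun ν => k * ν ≤ h * μ) = Finset.range (h * μ / k + 1) := by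
      ext ν
      rw [Finset.mem_filter, Finset.mem_range, Finset.mem_range, Nat.lt_succ_iff,
        Nat.le_div_iff_mul_le hk, mul_comm ν k]
      constructor
      · exact fun h => h.2
      · intro h1
        refine ⟨?_, h1⟩
        have : ν ≤ h * μ / k := by rwa [Nat.le_div_iff_mul_le hk, mul_comm ν k]
        omega
    rw [this, ← Finset.mul_sum, sum_range_natCast]
    push_cast
    ring
  rw [Finset.sum_congr rfl hcol, Finset.sum_comm]
  refine Finset.sum_congr rfl fun ν hν => ?_
  rw [Finset.mem_range] at hν
  rcases Nat.eq_zero_or_pos ν with rfl | h0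
  · simp
  rw [← Finset.sum_filter, Finset.sum_const, nsmul_eq_mul, mul_comm]
  congr 1
  have hg : k * ν / h < k := by
    rw [Nat.div_lt_iff_lt_mul hh]
    exact Nat.mul_lt_mul_of_pos_left hν hk
  -- Coprimality rules out lattice points on the line in a row `0 < ν < h`, so the weak inequality
  -- may be made strict.
  have : (Finset.range k).filter (fun μ => k * ν ≤ h * μ) = Finset.Ico (k * ν / h + 1) k := by
    ext μ
    rw [Finset.mem_filter, Finset.mem_range, Finset.mem_Ico, Nat.succ_le_iff,
      Nat.div_lt_iff_lt_mul hh, mul_comm μ h, and_comm]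
    refine and_congr_left fun hμ => ⟨fun h1 => lt_of_le_of_ne h1 fun h2 => ?_, le_of_lt⟩
    have h3 : h ∣ ν := hc.dvd_of_dvd_mul_left (h2 ▸ Dvd.intro _ rfl)
    have := Nat.le_of_dvd h0 h3
    omega
  rw [this, Nat.card_Ico, Nat.cast_sub (by omega)]
  push_cast
  ring

/-- Dedekind's reciprocity law. -/
theorem dedekindSum_reciprocity {h k : ℕ} (hh : 0 < h) (hk : 0 < k) (hc : Nat.Coprime h k) :
    12 * (dedekindSum h k + dedekindSum k h) =
      (h : ℚ) / k + (k : ℚ) / h + 1 / (h * k) - 3 := by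
  have hk' : (k : ℚ) ≠ 0 := by exact_mod_cast hk.ne'
  have hh' : (h : ℚ) ≠ 0 := by exact_mod_cast hh.ne'
  have hmod : ∀ m n : ℕ, ∀ μ : ℕ, ((m * μ % n : ℕ) : ℚ) = m * μ - n * (m * μ / n : ℕ) := by
    intro m n μ
    have : ((m * μ : ℕ) : ℚ) = n * (m * μ / n : ℕ) + (m * μ % n : ℕ) := by
      exact_mod_cast (Nat.div_add_mod (m * μ) n).symm
    push_cast at this ⊢
    linarith
  -- The residues `hμ - k⌊hμ/k⌋` permute `0, …, k - 1`: their sum determines `B` below, and their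
  -- sum of squares expresses `A` through `C`. The lattice count `e3` relates `C + B` to `A'`, and
  -- eliminating leaves reciprocity.
  have e1 := sum_range_mul_mod hk hc (fun μ => (μ : ℚ))
  have e2 := sum_range_mul_mod hk hc (fun μ => (μ : ℚ) ^ 2)
  have e3 := sum_div_mul_div_succ hh hk hc
  rw [dedekindSum_eq_sum_mod hk hc, dedekindSum_eq_sum_mod hh hc.symm]
  simp only [hmod] at e1 e2 ⊢
  rw [sum_range_natCast_sq] at e2
  rw [sum_range_natCast] at e1
  set A : ℚ := ∑ μ ∈ Finset.range k, (μ : ℚ) * (h * μ / k : ℕ) with hA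
  set A' : ℚ := ∑ ν ∈ Finset.range h, (ν : ℚ) * (k * ν / h : ℕ) with hA'
  set B : ℚ := ∑ μ ∈ Finset.range k, ((h * μ / k : ℕ) : ℚ) with hB
  set C : ℚ := ∑ μ ∈ Finset.range k, ((h * μ / k : ℕ) : ℚ) ^ 2 with hC
  have x1 : (h : ℚ) * (k * (k - 1) / 2) - k * B = k * (k - 1) / 2 := by
    rwa [Finset.sum_sub_distrib, ← Finset.mul_sum, ← Finset.mul_sum, sum_range_natCast] at e1
  have x2 : (h : ℚ) ^ 2 * ((k - 1) * k * (2 * k - 1) / 6) - 2 * h * k * A + k ^ 2 * C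
      = (k - 1) * k * (2 * k - 1) / 6 := by
    refine Eq.trans ?_ e2
    rw [← sum_range_natCast_sq, hA, hC, Finset.mul_sum, Finset.mul_sum, Finset.mul_sum,
      ← Finset.sum_sub_distrib, ← Finset.sum_add_distrib]
    exact Finset.sum_congr rfl fun μ _ => by ring
  have x3 : C + B = (k - 1) * (h * (h - 1)) - 2 * A' := by
    have l : C + B = ∑ μ ∈ Finset.range k, ((h * μ / k : ℕ) : ℚ) * ((h * μ / k : ℕ) + 1) := by
      rw [hC, hB, ← Finset.sum_add_distrib]
      exact Finset.sum_congr rfl fun μ _ => by ring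
    rw [l, e3, show ((k : ℚ) - 1) * (h * (h - 1)) = 2 * (k - 1) * (h * (h - 1) / 2) by ring,
      ← sum_range_natCast, hA', Finset.mul_sum, Finset.mul_sum, ← Finset.sum_sub_distrib]
    exact Finset.sum_congr rfl fun μ _ => by ring
  have x4 : ∑ μ ∈ Finset.range k, ((h : ℚ) * μ - k * (h * μ / k : ℕ)) * μ
      = h * ((k - 1) * k * (2 * k - 1) / 6) - k * A := by
    rw [← sum_range_natCast_sq, hA, Finset.mul_sum, Finset.mul_sum, ← Finset.sum_sub_distrib]
    exact Finset.sum_congr rfl fun μ _ => by ring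
  have x5 : ∑ ν ∈ Finset.range h, ((k : ℚ) * ν - h * (k * ν / h : ℕ)) * ν
      = k * ((h - 1) * h * (2 * h - 1) / 6) - h * A' := by
    rw [← sum_range_natCast_sq, hA', Finset.mul_sum, Finset.mul_sum, ← Finset.sum_sub_distrib]
    exact Finset.sum_congr rfl fun μ _ => by ring
  rw [x4, x5]
  have y1 : B = (h - 1) * (k - 1) / 2 := by
    field_simp
    apply mul_left_cancel₀ hk'
    linarith
  have y2 : A = ((h : ℚ) ^ 2 * ((k - 1) * k * (2 * k - 1) / 6) + k ^ 2 * C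
      - (k - 1) * k * (2 * k - 1) / 6) / (2 * h * k) := by
    rw [eq_div_iff (by positivity)]
    linarith
  have y3 : C = (k - 1) * (h * (h - 1)) - 2 * A' - (h - 1) * (k - 1) / 2 := by linarith
  rw [y2, y3]
  field_simp
  ring

/-! ### The Rademacher symbol under right multiplication -/

open ModularGroup (S T)

lemma det_entries (A : SL(2, ℤ)) : A 0 0 * A 1 1 - A 0 1 * A 1 0 = 1 := by
  have h := A.2
  rwa [Matrix.det_fin_two] at h

lemma coe_mul_T_zpow (A : SL(2, ℤ)) (n : ℤ) :
    ((A * T ^ n : SL(2, ℤ)) : Matrix (Fin 2) (Fin 2) ℤ) =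
      !![A 0 0, A 0 0 * n + A 0 1; A 1 0, A 1 0 * n + A 1 1] := by
  ext i j
  fin_cases i <;> fin_cases j <;>
    simp [ModularGroup.coe_T_zpow, Matrix.mul_apply, Fin.sum_univ_two]

lemma coe_mul_S (A : SL(2, ℤ)) :
    ((A * S : SL(2, ℤ)) : Matrix (Fin 2) (Fin 2) ℤ) = !![A 0 1, -A 0 0; A 1 1, -A 1 0] := by
  ext i j
  fin_cases i <;> fin_cases j <;>
    simp [ModularGroup.coe_S, Matrix.mul_apply, Fin.sum_univ_two]

lemma dedekindSum_zero_left (k : ℕ) : dedekindSum 0 k = 0 := by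
  simp [dedekindSum, sawtooth]

lemma rademacher_mul_T_zpow (A : SL(2, ℤ)) (n : ℤ) :
    rademacher (A * T ^ n) = rademacher A + n := by
  have hdet := det_entries A
  simp only [rademacher, coe_mul_T_zpow, Matrix.of_apply, Matrix.cons_val', Matrix.cons_val_zero,
    Matrix.cons_val_one, Matrix.cons_val_fin_one]
  by_cases hc : A 1 0 = 0
  · rw [if_pos hc, if_pos hc, hc]
    rw [hc, mul_zero, sub_zero] at hdet
    rcases Int.mul_eq_one_iff_eq_one_or_neg_one.1 hdet with ⟨h0, h1⟩ | ⟨h0, h1⟩ <;>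
      rw [h0, h1] <;> push_cast <;> ring
  · have hc' : (A 1 0 : ℚ) ≠ 0 := by exact_mod_cast hc
    have : A 1 0 * n + A 1 1 = A 1 1 + (A 1 0).sign * n * ((A 1 0).natAbs : ℤ) := by
      conv_lhs => rw [← Int.sign_mul_natAbs (A 1 0)]
      ring
    rw [if_neg hc, if_neg hc, this, dedekindSum_add_mul, ← this]
    push_cast
    field_simp
    ring

lemma rademacher_neg (A : SL(2, ℤ)) : rademacher (-A) = rademacher A := by
  simp only [rademacher, Matrix.SpecialLinearGroup.coe_neg, Matrix.neg_apply, neg_eq_zero,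
    Int.sign_neg, Int.natAbs_neg, dedekindSum_neg]
  push_cast
  rw [neg_div_neg_eq, ← neg_add, neg_div_neg_eq]
  ring_nf

/-- The determinant relation makes the rational parts differ by `-(c/d + d/c + 1/(cd))`.
Reciprocity, multiplied by `sgn(cd)`, cancels this and leaves only its constant `-3`. -/
lemma rademacher_mul_S (A : SL(2, ℤ)) :
    rademacher (A * S) = rademacher A - 3 * ((A 1 0 * A 1 1).sign : ℚ) := by
  have hdet := det_entries A
  simp only [rademacher, coe_mul_S, Matrix.of_apply, Matrix.cons_val', Matrix.cons_val_zero,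
    Matrix.cons_val_one, Matrix.cons_val_fin_one]
  by_cases hc : A 1 0 = 0
  · have hd : A 1 1 ≠ 0 := fun h => by simp [hc, h] at hdet
    rw [if_neg hd, if_pos hc, hc, neg_zero, dedekindSum_zero_left]
    simp
  by_cases hd : A 1 1 = 0
  · rw [if_pos hd, if_neg hc, hd, dedekindSum_zero_left]
    push_cast
    rw [neg_div_neg_eq]
    simp
  rw [if_neg hc, if_neg hd]
  generalize A 0 0 = a at *
  generalize A 0 1 = b at *
  generalize A 1 0 = c at *
  generalize A 1 1 = d at *
  have hco : Nat.Coprime c.natAbs d.natAbs := by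
    rw [← Int.isCoprime_iff_nat_coprime]
    exact ⟨-b, a, by linarith⟩
  have hrec := dedekindSum_reciprocity (Int.natAbs_pos.2 hc) (Int.natAbs_pos.2 hd) hco
  have hq : (a : ℚ) * d - b * c = 1 := by exact_mod_cast hdet
  have hc' : (c : ℚ) ≠ 0 := by exact_mod_cast hc
  have hd' : (d : ℚ) ≠ 0 := by exact_mod_cast hd
  have key : ((b : ℚ) + -c) / d - (a + d) / c = -(c / d + d / c + 1 / (c * d)) := by
    field_simp
    linear_combination -hq
  obtain ⟨m, rfl | rfl⟩ := Int.eq_nat_or_neg c <;> obtain ⟨n, rfl | rfl⟩ := Int.eq_nat_or_neg d <;>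
  · have hm : (0 : ℤ) < m := by omega
    have hn : (0 : ℤ) < n := by omega
    simp only [Int.natAbs_neg, Int.natAbs_natCast, Int.sign_neg, dedekindSum_neg, neg_neg,
      Int.sign_eq_one_of_pos hm, Int.sign_eq_one_of_pos hn, Int.sign_mul, Int.cast_neg,
      Int.cast_natCast, Int.cast_one, neg_mul, mul_neg, mul_one, div_neg,
      neg_div] at *
    linarith

lemma rademacher_S : rademacher S = 0 := by
  simp [rademacher, ModularGroup.coe_S, dedekindSum_zero_left]

/-! ### Signatures of tridiagonal forms -/

/-- The sum of the signs of the products of successive terms of the sequence that starts with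
`d, c` and satisfies `x (j + 2) = a j * x (j + 1) - x j`. -/
def signWalk : ℕ → (ℕ → ℝ) → ℝ → ℝ → ℤ
  | 0, _, _, _ => 0
  | k + 1, a, c, d =>
      (SignType.sign (c * (a 0 * c - d)) : ℤ) + signWalk k (fun i => a (i + 1)) (a 0 * c - d) c

lemma signWalk_smul {t : ℝ} (ht : t ≠ 0) (k : ℕ) (a : ℕ → ℝ) (c d : ℝ) :
    signWalk k a (t * c) (t * d) = signWalk k a c d := by
  induction k generalizing a c d with
  | zero => rfl
  | succ k ih =>
    have h1 : a 0 * (t * c) - t * d = t * (a 0 * c - d) := by ring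
    have h2 : t * c * (t * (a 0 * c - d)) = t ^ 2 * (c * (a 0 * c - d)) := by ring
    rw [signWalk, signWalk, h1, ih, h2, sign_mul, sign_pos (by positivity : 0 < t ^ 2), one_mul]

/-- Completing the square in the first variable replaces `a 1` by `a 1 - 1 / a 0`. The walk of the
reduced form is the tail of the original one divided by `a 0`, which changes no sign of a product.
-/
lemma signWalk_shift {a : ℕ → ℝ} (h : a 0 ≠ 0) (k : ℕ) :
    signWalk k (fun i => if i = 0 then a 1 - 1 / a 0 else a (i + 1)) 1 0 =
      signWalk k (fun i => a (i + 1)) (a 0) 1 := by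
  cases k with
  | zero => rfl
  | succ k =>
    have h1 : a 1 * a 0 - 1 = a 0 * (a 1 - 1 / a 0) := by field_simp
    have h2 : a 0 * (a 0 * (a 1 - 1 / a 0)) = a 0 ^ 2 * (a 1 - 1 / a 0) := by ring
    have h3 := signWalk_smul h k (fun i => a (i + 1 + 1)) (a 1 - 1 / a 0) 1
    rw [mul_one] at h3
    simp only [signWalk, if_true, one_mul, mul_one, sub_zero, zero_add, Nat.succ_ne_zero, if_false]
    rw [h1, h3, h2, sign_mul, sign_pos (by positivity : 0 < a 0 ^ 2), one_mul]

lemma signWalk_eq_sum (C : ℕ → ℝ) (a : ℕ → ℝ) (h : ∀ j, C (j + 2) = a j * C (j + 1) - C j)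
    (k : ℕ) :
    signWalk k a (C 1) (C 0) =
      ∑ j ∈ Finset.range k, (SignType.sign (C (j + 1) * C (j + 2)) : ℤ) := by
  induction k generalizing C a with
  | zero => rfl
  | succ k ih =>
    rw [signWalk, Finset.sum_range_succ', ← h 0,
      ih (fun j => C (j + 1)) (fun j => a (j + 1)) (fun j => h (j + 1)), add_comm]

/-- The shift of sequences. -/
def shiftLin : (ℕ → ℝ) →ₗ[ℝ] (ℕ → ℝ) := LinearMap.funLeft ℝ ℝ Nat.succ

@[simp] lemma shiftLin_apply (x : ℕ → ℝ) (i : ℕ) : shiftLin x i = x (i + 1) := rfl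

/-- The coordinate functionals on sequences. -/
def coordLin (i : ℕ) : (ℕ → ℝ) →ₗ[ℝ] ℝ := LinearMap.proj i

@[simp] lemma coordLin_apply (i : ℕ) (x : ℕ → ℝ) : coordLin i x = x i := rfl

/-- On the sequences supported on `{0, …, k - 1}`, the tridiagonal form with diagonal `a` is
`∑ w i * (l i)²`, and the functionals `l i` have no common zero but `0`. -/
structure Diagonalizes (k : ℕ) (a w : ℕ → ℝ) (l : ℕ → (ℕ → ℝ) →ₗ[ℝ] ℝ) : Prop where
  eq_zero : ∀ x : ℕ → ℝ, x k = 0 → (∀ i < k, l i x = 0) → ∀ i < k, x i = 0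
  sum_eq : ∀ x : ℕ → ℝ, x k = 0 →
    ∑ i ∈ Finset.range k, (a i * x i ^ 2 + 2 * x i * x (i + 1)) =
      ∑ i ∈ Finset.range k, w i * l i x ^ 2

/-- Lagrange reduction by strong induction: a nonzero `a 0` splits off one square, while a zero `a
0` followed by another variable splits off a hyperbolic plane, removing two variables and
contributing no signature. -/
lemma exists_diagonalizes (k : ℕ) : ∀ a : ℕ → ℝ, ∃ w l, Diagonalizes k a w l ∧
    ∑ i ∈ Finset.range k, (SignType.sign (w i) : ℤ) = signWalk k a 1 0 := by
  induction k using Nat.strong_induction_on with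
  | _ k ih =>
  intro a
  match k, ih with
  | 0, _ => exact ⟨0, 0, ⟨by simp, by simp⟩, rfl⟩
  | k + 1, ih =>
  by_cases h0 : a 0 = 0
  · match k, ih with
    | 0, _ =>
      refine ⟨0, fun _ => coordLin 0, ⟨fun x _ h => by simpa using h, fun x hx => ?_⟩, ?_⟩
      · rw [zero_add] at hx
        simp [h0, hx]
      · simp [signWalk, h0]
    | m + 1, ih =>
      obtain ⟨w, l, ⟨hl, hs⟩, hw⟩ := ih m (by omega) (fun i => a (i + 2))
      -- For `a 0 = 0` the terms containing `x 0` or `x 1` add up to `2 * x 1 * y = (x 1 + y)² / 2 -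
      -- (x 1 - y)² / 2`.
      let y : (ℕ → ℝ) →ₗ[ℝ] ℝ :=
        coordLin 0 + (a 1 / 2) • coordLin 1 + coordLin 2
      have hy : ∀ x, y x = x 0 + a 1 / 2 * x 1 + x 2 := fun x => rfl
      refine ⟨fun i => match i with | 0 => 1 / 2 | 1 => -(1 / 2) | i + 2 => w i,
        fun i => match i with
          | 0 => coordLin 1 + y
          | 1 => coordLin 1 - y
          | i + 2 => l i ∘ₗ shiftLin ∘ₗ shiftLin, ⟨fun x hx h => ?_, fun x hx => ?_⟩, ?_⟩
      · have e0 : x 1 + y x = 0 := h 0 (by omega)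
        have e1 : x 1 - y x = 0 := h 1 (by omega)
        have e2 : ∀ i < m, x (i + 2) = 0 :=
          hl (shiftLin (shiftLin x)) hx fun i hi => h (i + 2) (by omega)
        have e3 : x 2 = 0 := by
          rcases Nat.eq_zero_or_pos m with rfl | hm
          · exact hx
          · exact e2 0 hm
        rw [hy] at e0 e1
        have e4 : x 1 = 0 := by linarith
        intro i hi
        match i with
        | 0 => rw [e4, e3] at e0; linarith
        | 1 => exact e4
        | i + 2 => exact e2 i (by omega)
      · rw [Finset.sum_range_succ', Finset.sum_range_succ', Finset.sum_range_succ',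
          Finset.sum_range_succ']
        have := hs (shiftLin (shiftLin x)) hx
        simp only [shiftLin_apply] at this
        simp only [LinearMap.comp_apply, LinearMap.add_apply, LinearMap.sub_apply, hy,
          coordLin_apply, ← this, h0]
        ring
      · rw [Finset.sum_range_succ', Finset.sum_range_succ']
        -- From `0, 1` the recurrence continues with `0, -1`: the walk restarts with reversed sign
        -- after two zero products.
        have h1 := signWalk_smul (t := -1) (by norm_num) m (fun i => a (i + 2)) 1 0
        rw [mul_zero, mul_one] at h1
        simp only [hw, signWalk, h0]
        rw [sign_pos (by norm_num : (0 : ℝ) < 1 / 2), sign_neg (by norm_num : -(1 / 2) < (0 : ℝ))]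
        simp [h1]
  · obtain ⟨w, l, ⟨hl, hs⟩, hw⟩ :=
      ih k (by omega) (fun i => if i = 0 then a 1 - 1 / a 0 else a (i + 1))
    -- `a 0 * y²` absorbs `x 0` and leaves `-(x 1)² / a 0` for the next diagonal entry.
    let y : (ℕ → ℝ) →ₗ[ℝ] ℝ := coordLin 0 + (1 / a 0) • coordLin 1
    have hy : ∀ x, y x = x 0 + 1 / a 0 * x 1 := fun x => rfl
    refine ⟨fun i => match i with | 0 => a 0 | i + 1 => w i,
      fun i => match i with | 0 => y | i + 1 => l i ∘ₗ shiftLin,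
      ⟨fun x hx h => ?_, fun x hx => ?_⟩, ?_⟩
    · have e0 : y x = 0 := h 0 (by omega)
      have e1 : ∀ i < k, x (i + 1) = 0 := hl (shiftLin x) hx fun i hi => h (i + 1) (by omega)
      have e2 : x 1 = 0 := by
        rcases Nat.eq_zero_or_pos k with rfl | hk
        · exact hx
        · exact e1 0 hk
      rw [hy, e2, mul_zero, add_zero] at e0
      intro i hi
      match i with
      | 0 => exact e0
      | i + 1 => exact e1 i (by omega)
    · have := hs (shiftLin x) hx
      rw [Finset.sum_range_succ', Finset.sum_range_succ']
      simp only [LinearMap.comp_apply, ← this, hy, shiftLin_apply]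
      cases k with
      | zero =>
        rw [zero_add] at hx
        simp [hx]
      | succ k =>
        rw [Finset.sum_range_succ', Finset.sum_range_succ']
        simp only [if_true, Nat.succ_ne_zero, if_false]
        field_simp
        ring
    · rw [Finset.sum_range_succ', hw, signWalk_shift h0]
      simp only [signWalk, one_mul, mul_one, sub_zero]
      ring

/-- Extension of a vector by zeros. -/
def extendLin (k : ℕ) : (Fin k → ℝ) →ₗ[ℝ] (ℕ → ℝ) where
  toFun x i := if h : i < k then x ⟨i, h⟩ else 0
  map_add' x y := by
    funext i
    by_cases h : i < k <;> simp [h]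
  map_smul' t x := by
    funext i
    by_cases h : i < k <;> simp [h]

lemma extendLin_of_lt {k : ℕ} (x : Fin k → ℝ) (i : Fin k) : extendLin k x i = x i := by
  simp [extendLin]

lemma extendLin_self {k : ℕ} (x : Fin k → ℝ) : extendLin k x k = 0 := by
  simp [extendLin]

lemma sum_sign_eq_ncard {k : ℕ} (w : Fin k → ℝ) :
    ∑ i, (SignType.sign (w i) : ℤ) = ({i | 0 < w i}.ncard : ℤ) - ({i | w i < 0}.ncard : ℤ) := by
  classical
  have h : ∀ t : ℝ, (SignType.sign t : ℤ) = (if 0 < t then 1 else 0) - if t < 0 then 1 else 0 := by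
    intro t
    rcases lt_trichotomy t 0 with ht | rfl | ht
    · simp [ht, ht.not_gt]
    · simp
    · simp [ht, ht.not_gt]
  simp only [h, Finset.sum_sub_distrib, Finset.sum_boole, Set.ncard_eq_toFinset_card',
    Set.toFinset_ofPred]

/-- The tridiagonal matrix with diagonal `a` and entries `1` next to the diagonal. -/
def tridiag (k : ℕ) (a : ℕ → ℝ) : Matrix (Fin k) (Fin k) ℝ :=
  Matrix.of fun i j =>
    if i = j then a i
    else if (i : ℕ) + 1 = (j : ℕ) ∨ (j : ℕ) + 1 = (i : ℕ) then 1 else 0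

lemma toQuadraticForm'_tridiag (k : ℕ) (a : ℕ → ℝ) (x : Fin k → ℝ) :
    (tridiag k a).toQuadraticForm' x = ∑ i ∈ Finset.range k,
      (a i * extendLin k x i ^ 2 + 2 * extendLin k x i * extendLin k x (i + 1)) := by
  have h0 : (tridiag k a).toQuadraticForm' x = ∑ i, ∑ j, x i * tridiag k a i j * x j := by
    simp only [Matrix.toQuadraticForm', LinearMap.BilinMap.toQuadraticMap_apply,
      Matrix.toLinearMap₂'_apply, smul_eq_mul]
    exact Finset.sum_congr rfl fun i _ => Finset.sum_congr rfl fun j _ => by ring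
  have h1 : ∀ i j : Fin k, x i * tridiag k a i j * x j = (if i = j then a i * x i * x j else 0) +
      (if (i : ℕ) + 1 = j then x i * x j else 0) + if (j : ℕ) + 1 = i then x j * x i else 0 := by
    intro i j
    simp only [tridiag, Matrix.of_apply]
    by_cases hij : i = j
    · subst hij
      rw [if_pos rfl, if_pos rfl, if_neg (by omega)]
      ring
    · by_cases h2 : (i : ℕ) + 1 = j
      · have h3 : ¬ ((j : ℕ) + 1 = i) := by omega
        simp [hij, h2, h3]
      · by_cases h3 : (j : ℕ) + 1 = i
        · simp [hij, h2, h3, mul_comm]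
        · simp [hij, h2, h3]
  have h2 : ∀ i : Fin k, ∑ j : Fin k, (if (i : ℕ) + 1 = j then x i * x j else 0) =
      extendLin k x i * extendLin k x (i + 1) := by
    intro i
    by_cases hi : (i : ℕ) + 1 < k
    · rw [Finset.sum_eq_single (⟨i + 1, hi⟩ : Fin k)]
      · simp [extendLin, hi]
      · intro j _ hj
        rw [if_neg fun h => hj (Fin.ext h.symm)]
      · simp
    · rw [Finset.sum_eq_zero]
      · simp [extendLin, hi]
      · intro j _
        rw [if_neg (by omega)]
  rw [h0]
  simp only [h1, Finset.sum_add_distrib]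
  rw [Finset.sum_comm (f := fun i j : Fin k => if (j : ℕ) + 1 = i then x j * x i else 0)]
  simp only [h2, Finset.sum_ite_eq, Finset.mem_univ, if_true]
  rw [← Finset.sum_add_distrib, ← Finset.sum_add_distrib, ← Finset.sum_add_distrib,
    ← Fin.sum_univ_eq_sum_range (fun i => a i * extendLin k x i ^ 2
      + 2 * extendLin k x i * extendLin k x (i + 1))]
  refine Finset.sum_congr rfl fun i _ => ?_
  rw [extendLin_of_lt]
  ring

/-- The `k` functionals of `exists_diagonalizes` have no common zero but `0`, so they are
coordinates in which the form is diagonal, and Sylvester's law of inertia applies. -/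
theorem sig_tridiag (k : ℕ) (a : ℕ → ℝ) :
    (sigPos (tridiag k a).toQuadraticForm' : ℤ) - (sigNeg (tridiag k a).toQuadraticForm' : ℤ) =
      signWalk k a 1 0 := by
  obtain ⟨w, l, ⟨hl, hs⟩, hw⟩ := exists_diagonalizes k a
  let f : (Fin k → ℝ) →ₗ[ℝ] (Fin k → ℝ) := LinearMap.pi fun i => l i ∘ₗ extendLin k
  have hf : Function.Injective f := by
    rw [← LinearMap.ker_eq_bot, LinearMap.ker_eq_bot']
    intro x hx
    funext i
    rw [← extendLin_of_lt x i]
    exact hl _ (extendLin_self x) (fun j hj => congrFun hx ⟨j, hj⟩) i i.2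
  have he : QuadraticMap.Equivalent (tridiag k a).toQuadraticForm'
      (QuadraticMap.weightedSumSquares ℝ fun i : Fin k => w i) := by
    refine ⟨⟨LinearEquiv.ofInjectiveEndo f hf, fun x => ?_⟩⟩
    rw [toQuadraticForm'_tridiag, hs _ (extendLin_self x), QuadraticMap.weightedSumSquares_apply,
      ← Fin.sum_univ_eq_sum_range (fun i => w i * l i (extendLin k x) ^ 2)]
    refine Finset.sum_congr rfl fun i _ => ?_
    change w i * (f x i * f x i) = w i * f x i ^ 2
    ring
  rw [QuadraticForm.sigPos_of_equiv_weightedSumSquares he,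
    QuadraticForm.sigNeg_of_equiv_weightedSumSquares he, ← sum_sign_eq_ncard, ← hw,
    Fin.sum_univ_eq_sum_range (fun i => (SignType.sign (w i) : ℤ))]

/-! ### The normalizer of `Γ₀(p)` -/

lemma det_entries_real (N : SL(2, ℝ)) : N 0 0 * N 1 1 - N 0 1 * N 1 0 = 1 := by
  have h := N.2
  rwa [Matrix.det_fin_two] at h

lemma toReal_apply (g : SL(2, ℤ)) (i j : Fin 2) : toReal g i j = (g i j : ℝ) := rfl

lemma mem_gamma0Real_iff {p : ℕ} {M : SL(2, ℝ)} :
    M ∈ gamma0Real p ↔ ∃ a b c d : ℤ,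
      M 0 0 = a ∧ M 0 1 = b ∧ M 1 0 = p * c ∧ M 1 1 = d := by
  constructor
  · rintro ⟨g, hg, rfl⟩
    obtain ⟨c, hc⟩ : (p : ℤ) ∣ g 1 0 :=
      (ZMod.intCast_zmod_eq_zero_iff_dvd _ p).1 (CongruenceSubgroup.Gamma0_mem.1 hg)
    refine ⟨g 0 0, g 0 1, c, g 1 1, rfl, rfl, ?_, rfl⟩
    rw [toReal_apply, hc]
    push_cast
    rfl
  · rintro ⟨a, b, c, d, ha, hb, hc, hd⟩
    have hdet := det_entries_real M
    rw [ha, hb, hc, hd] at hdet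
    let g : SL(2, ℤ) := ⟨!![a, b; p * c, d], by
      rw [Matrix.det_fin_two_of]
      exact_mod_cast hdet⟩
    have hg : g 1 0 = p * c := rfl
    refine ⟨g, ?_, ?_⟩
    · rw [SetLike.mem_coe, CongruenceSubgroup.Gamma0_mem, hg]
      simp
    · ext i j
      fin_cases i <;> fin_cases j
      · exact ha.symm
      · exact hb.symm
      · refine Eq.trans ?_ hc.symm
        change ((g 1 0 : ℤ) : ℝ) = p * c
        rw [hg]
        push_cast
        rfl
      · exact hd.symm

lemma conj_entries (N h : SL(2, ℝ)) :
    ((N * h * N⁻¹ : SL(2, ℝ)) : Matrix (Fin 2) (Fin 2) ℝ) =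
      !![(N 0 0 * h 0 0 + N 0 1 * h 1 0) * N 1 1 - (N 0 0 * h 0 1 + N 0 1 * h 1 1) * N 1 0,
        (N 0 0 * h 0 1 + N 0 1 * h 1 1) * N 0 0 - (N 0 0 * h 0 0 + N 0 1 * h 1 0) * N 0 1;
        (N 1 0 * h 0 0 + N 1 1 * h 1 0) * N 1 1 - (N 1 0 * h 0 1 + N 1 1 * h 1 1) * N 1 0,
        (N 1 0 * h 0 1 + N 1 1 * h 1 1) * N 0 0 - (N 1 0 * h 0 0 + N 1 1 * h 1 0) * N 0 1] := by
  ext i j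
  fin_cases i <;> fin_cases j <;>
    simp [Matrix.mul_apply, Fin.sum_univ_two, Matrix.SpecialLinearGroup.coe_inv,
      Matrix.adjugate_fin_two] <;> ring

/-- The integrality of the conjugate of `(e, f; g, i) ∈ Γ₀(p)` by an element of the normalizer. -/
lemma conj_integral {p : ℕ} {N : SL(2, ℝ)} (hN : N ∈ gamma0Plus p) (e f g i : ℤ)
    (hdet : e * i - f * (p * g) = 1) : ∃ a b c d : ℤ,
      (N 0 0 * e + N 0 1 * (p * g)) * N 1 1 - (N 0 0 * f + N 0 1 * i) * N 1 0 = a ∧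
      (N 0 0 * f + N 0 1 * i) * N 0 0 - (N 0 0 * e + N 0 1 * (p * g)) * N 0 1 = b ∧
      (N 1 0 * e + N 1 1 * (p * g)) * N 1 1 - (N 1 0 * f + N 1 1 * i) * N 1 0 = p * c ∧
      (N 1 0 * f + N 1 1 * i) * N 0 0 - (N 1 0 * e + N 1 1 * (p * g)) * N 0 1 = d := by
  let h : SL(2, ℝ) := ⟨!![(e : ℝ), f; p * g, i], by
    rw [Matrix.det_fin_two_of]
    exact_mod_cast hdet⟩
  have hh : h ∈ gamma0Real p := mem_gamma0Real_iff.2 ⟨e, f, g, i, rfl, rfl, rfl, rfl⟩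
  have h1 : N * h * N⁻¹ ∈ gamma0Real p := (Subgroup.mem_normalizer_iff.1 hN h).1 hh
  obtain ⟨a, b, c, d, h2⟩ := mem_gamma0Real_iff.1 h1
  rw [conj_entries] at h2
  exact ⟨a, b, c, d, h2⟩

/-- The products of entries of an element of the normalizer that are integral because
`(1, 1; 0, 1)` and `(1, 0; p, 1)` are conjugated into `Γ₀(p)`. -/
lemma exists_int_products {p : ℕ} (hp : p ≠ 0) {N : SL(2, ℝ)} (hN : N ∈ gamma0Plus p) :
    (∃ m : ℤ, N 0 0 ^ 2 = m) ∧ (∃ m : ℤ, N 0 0 * N 1 0 = m) ∧ (∃ m : ℤ, N 1 0 ^ 2 = p * m) ∧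
      (∃ m : ℤ, p * N 0 1 ^ 2 = m) ∧ (∃ m : ℤ, p * (N 0 1 * N 1 1) = m) ∧
      ∃ m : ℤ, N 1 1 ^ 2 = m := by
  have hdet := det_entries_real N
  have hp' : (p : ℝ) ≠ 0 := by exact_mod_cast hp
  obtain ⟨a, b, c, d, h1, h2, h3, h4⟩ := conj_integral hN 1 1 0 1 (by ring)
  obtain ⟨a', b', c', d', h1', h2', h3', h4'⟩ := conj_integral hN 1 0 1 1 (by ring)
  push_cast at *
  refine ⟨⟨b, by linarith⟩, ⟨1 - a, ?_⟩, ⟨-c, ?_⟩, ⟨-b', ?_⟩, ⟨a' - 1, ?_⟩, ⟨c', ?_⟩⟩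
  · push_cast; linarith
  · push_cast; linarith
  · push_cast; linarith
  · push_cast; linarith
  · apply mul_left_cancel₀ hp'; linarith

/-- Scaling by `p` times a nonzero entry of the first row turns all entries into products whose
integrality comes from conjugations. -/
lemma exists_int_mul_entries {p : ℕ} (hp : p ≠ 0) {N : SL(2, ℝ)} (hN : N ∈ gamma0Plus p) :
    ∃ t : ℝ, t ≠ 0 ∧ ∃ a b c d : ℤ,
      t * N 0 0 = a ∧ t * N 0 1 = b ∧ t * N 1 0 = c ∧ t * N 1 1 = d := by
  have hdet := det_entries_real N
  have hp' : (p : ℝ) ≠ 0 := by exact_mod_cast hp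
  obtain ⟨⟨X, hX⟩, ⟨U, hU⟩, -, ⟨Y, hY⟩, ⟨V, hV⟩, -⟩ := exists_int_products hp hN
  by_cases hx : N 0 0 = 0
  · rw [hx, zero_mul, zero_sub] at hdet
    have hy : N 0 1 ≠ 0 := fun h => by simp [h] at hdet
    refine ⟨p * N 0 1, mul_ne_zero hp' hy, 0, Y, -p, V, ?_, ?_, ?_, ?_⟩
    · simp [hx]
    · rw [← hY]; ring
    · push_cast; linear_combination -(p : ℝ) * hdet
    · rw [← hV]; ring
  · obtain ⟨-, -, -, -, ⟨V', hV'⟩, -⟩ := exists_int_products hp (inv_mem hN)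
    rw [Matrix.SpecialLinearGroup.coe_inv, Matrix.adjugate_fin_two] at hV'
    simp only [Matrix.of_apply, Matrix.cons_val', Matrix.cons_val_zero,
      Matrix.cons_val_one, Matrix.cons_val_fin_one] at hV'
    -- The remaining product `p * N 0 0 * N 1 1` is read off from the conjugate of `(1 + p, 1; p,
    -- 1)`.
    obtain ⟨a, b, c, d, h1, -⟩ := conj_integral hN (1 + p) 1 1 1 (by ring)
    push_cast at h1
    refine ⟨p * N 0 0, mul_ne_zero hp' hx, p * X, -V', p * U, a - 1 - V + U, ?_, ?_, ?_, ?_⟩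
    · push_cast; rw [← hX]; ring
    · push_cast; rw [← hV']; ring
    · push_cast; rw [← hU]; ring
    · push_cast; rw [← hV, ← hU, ← h1]; linear_combination -hdet

lemma exists_primitive_entries {p : ℕ} (hp : p ≠ 0) {N : SL(2, ℝ)} (hN : N ∈ gamma0Plus p) :
    ∃ s : ℝ, 0 < s ∧ ∃ a b c d : ℤ,
      s * N 0 0 = a ∧ s * N 0 1 = b ∧ s * N 1 0 = c ∧ s * N 1 1 = d ∧
      ∀ q : ℕ, q.Prime → (q : ℤ) ∣ a → (q : ℤ) ∣ b → (q : ℤ) ∣ c → (q : ℤ) ∣ d → False := by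
  obtain ⟨t, ht, ht'⟩ : ∃ t : ℝ, 0 < t ∧ ∃ a b c d : ℤ,
      t * N 0 0 = a ∧ t * N 0 1 = b ∧ t * N 1 0 = c ∧ t * N 1 1 = d := by
    obtain ⟨t, ht, a, b, c, d, h1, h2, h3, h4⟩ := exists_int_mul_entries hp hN
    rcases ht.lt_or_gt with h | h
    · refine ⟨-t, by linarith, -a, -b, -c, -d, ?_⟩
      push_cast
      simp [h1, h2, h3, h4]
    · exact ⟨t, h, a, b, c, d, h1, h2, h3, h4⟩
  obtain ⟨a, b, c, d, h1, h2, h3, h4⟩ := ht'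
  set g : ℤ := GCDMonoid.gcd (GCDMonoid.gcd a b) (GCDMonoid.gcd c d) with hg
  obtain ⟨a', ha⟩ : g ∣ a := (gcd_dvd_left _ _).trans (gcd_dvd_left _ _)
  obtain ⟨b', hb⟩ : g ∣ b := (gcd_dvd_left _ _).trans (gcd_dvd_right _ _)
  obtain ⟨c', hc⟩ : g ∣ c := (gcd_dvd_right _ _).trans (gcd_dvd_left _ _)
  obtain ⟨d', hd⟩ : g ∣ d := (gcd_dvd_right _ _).trans (gcd_dvd_right _ _)
  have hmax : ∀ e, e ∣ a → e ∣ b → e ∣ c → e ∣ d → e ∣ g := fun e ea eb ec ed =>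
    dvd_gcd (dvd_gcd ea eb) (dvd_gcd ec ed)
  have hg0 : g ≠ 0 := by
    intro h0
    rw [h0, zero_mul] at ha hb hc hd
    rw [ha] at h1
    rw [hb] at h2
    have hdet := det_entries_real N
    have e1 : N 0 0 = 0 := by simpa [ht.ne'] using h1
    have e2 : N 0 1 = 0 := by simpa [ht.ne'] using h2
    rw [e1, e2] at hdet
    simp at hdet
  have hgpos : 0 < g := by
    rcases hg0.lt_or_gt with h | h
    · have h5 : normalize g = g := by simp [hg]
      rw [Int.normalize_of_nonpos h.le] at h5
      omega
    · exact h
  have hgr : (0 : ℝ) < g := by exact_mod_cast hgpos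
  have hdiv : ∀ m m' : ℤ, m = g * m' → ∀ x : ℝ, t * x = m → t / g * x = m' := by
    intro m m' hm x hx
    rw [hm] at hx
    push_cast at hx
    field_simp
    linarith
  refine ⟨t / g, by positivity, a', b', c', d', hdiv _ _ ha _ h1, hdiv _ _ hb _ h2,
    hdiv _ _ hc _ h3, hdiv _ _ hd _ h4, fun q hq qa qb qc qd => ?_⟩
  have h5 : g * q ∣ g := hmax _ (ha ▸ mul_dvd_mul_left g qa) (hb ▸ mul_dvd_mul_left g qb)
    (hc ▸ mul_dvd_mul_left g qc) (hd ▸ mul_dvd_mul_left g qd)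
  have h6 : (q : ℤ) ∣ 1 := by
    rw [← mul_dvd_mul_iff_left hg0, mul_one]
    exact h5
  have h7 : q ∣ 1 := by exact_mod_cast h6
  exact hq.one_lt.ne' (Nat.dvd_one.1 h7)

/-- The determinant of a primitive integral multiple of a normalizing matrix is `1` or `p`. -/
lemma det_eq_one_or_prime {p : ℕ} (hp : p.Prime) {a b c d D X Y Z W : ℤ} (hD : 0 < D)
    (hX : a ^ 2 = D * X) (hW : d ^ 2 = D * W) (hZ : c ^ 2 = D * (p * Z)) (hY : p * b ^ 2 = D * Y)
    (hprim : ∀ q : ℕ, q.Prime →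
      (q : ℤ) ∣ a → (q : ℤ) ∣ b → (q : ℤ) ∣ c → (q : ℤ) ∣ d → False) :
    D = 1 ∨ D = p := by
  have hdvd : ∀ q : ℕ, q.Prime → (q : ℤ) ∣ D → (q : ℤ) ∣ a ∧ (q : ℤ) ∣ c ∧ (q : ℤ) ∣ d := by
    intro q hq hqD
    have hq' := Nat.prime_iff_prime_int.1 hq
    exact ⟨hq'.dvd_of_dvd_pow (n := 2) (hX ▸ hqD.mul_right _),
      hq'.dvd_of_dvd_pow (n := 2) (hZ ▸ hqD.mul_right _),
      hq'.dvd_of_dvd_pow (n := 2) (hW ▸ hqD.mul_right _)⟩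
  have hne : ∀ q : ℕ, q.Prime → (q : ℤ) ∣ D → q = p := by
    intro q hq hqD
    by_contra hqp
    obtain ⟨qa, qc, qd⟩ := hdvd q hq hqD
    have hq' := Nat.prime_iff_prime_int.1 hq
    refine hprim q hq qa ?_ qc qd
    have h1 : (q : ℤ) ∣ p * b ^ 2 := hY ▸ hqD.mul_right _
    rcases hq'.dvd_or_dvd h1 with h2 | h2
    · exact absurd ((Nat.prime_dvd_prime_iff_eq hq hp).1 (by exact_mod_cast h2)) hqp
    · exact hq'.dvd_of_dvd_pow h2
  have hunit : ∀ E : ℤ, 0 < E → (∀ q : ℕ, q.Prime → ¬ (q : ℤ) ∣ E) → E = 1 := by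
    intro E hE h
    by_contra h1
    obtain ⟨q, hq, hqE⟩ := Nat.exists_prime_and_dvd (n := E.natAbs) (by omega)
    exact h q hq (Int.natCast_dvd.2 hqE)
  by_cases hpD : (p : ℤ) ∣ D
  · right
    obtain ⟨E, rfl⟩ := hpD
    have hp0 : (0 : ℤ) < p := by exact_mod_cast hp.pos
    have hE : 0 < E := pos_of_mul_pos_right hD hp0.le
    rw [hunit E hE, mul_one]
    intro q hq hqE
    obtain rfl : q = p := hne q hq (hqE.mul_left _)
    obtain ⟨qa, qc, qd⟩ := hdvd q hq (dvd_mul_right _ _)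
    refine hprim q hq qa ?_ qc qd
    -- Were `p²` to divide the determinant, cancelling one `p` here would give `p ∣ b`, against
    -- primitivity.
    have h1 : (q : ℤ) * b ^ 2 = q * (E * Y) := by rw [hY]; ring
    have h2 := mul_left_cancel₀ hp0.ne' h1
    exact (Nat.prime_iff_prime_int.1 hq).dvd_of_dvd_pow (h2 ▸ hqE.mul_right _)
  · left
    refine hunit D hD fun q hq hqD => hpD ?_
    rwa [← hne q hq hqD]

/-- The primitive multiple `s N` has determinant `s²`. If it is `1`, then `N` is integral with `p ∣
c`; if it is `p`, then `s = √p` and `p` divides `a`, `c`, `d`, so that `W_p⁻¹ N` is integral. -/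
theorem mem_gamma0Real_or_frickeTwist_mem {p : ℕ} [NeZero p] (hp : p.Prime) {N : SL(2, ℝ)}
    (hN : N ∈ gamma0Plus p) : N ∈ gamma0Real p ∨ frickeTwist p N ∈ gamma0Real p := by
  have hdet := det_entries_real N
  obtain ⟨s, hs, a, b, c, d, h1, h2, h3, h4, hprim⟩ := exists_primitive_entries hp.ne_zero hN
  obtain ⟨⟨X, hX⟩, -, ⟨Z, hZ⟩, ⟨Y, hY⟩, -, ⟨W, hW⟩⟩ := exists_int_products hp.ne_zero hN
  have hD : ((a * d - b * c : ℤ) : ℝ) = s ^ 2 := by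
    push_cast
    rw [← h1, ← h2, ← h3, ← h4]
    linear_combination s ^ 2 * hdet
  have hDpos : 0 < a * d - b * c := by
    have : (0 : ℝ) < ((a * d - b * c : ℤ) : ℝ) := by rw [hD]; positivity
    exact_mod_cast this
  have eX : a ^ 2 = (a * d - b * c) * X := by
    have : ((a ^ 2 : ℤ) : ℝ) = ((a * d - b * c : ℤ) : ℝ) * X := by
      rw [hD, ← hX]; push_cast; rw [← h1]; ring
    exact_mod_cast this
  have eW : d ^ 2 = (a * d - b * c) * W := by
    have : ((d ^ 2 : ℤ) : ℝ) = ((a * d - b * c : ℤ) : ℝ) * W := by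
      rw [hD, ← hW]; push_cast; rw [← h4]; ring
    exact_mod_cast this
  have eZ : c ^ 2 = (a * d - b * c) * (p * Z) := by
    have : ((c ^ 2 : ℤ) : ℝ) = ((a * d - b * c : ℤ) : ℝ) * (p * Z) := by
      rw [hD, ← hZ]; push_cast; rw [← h3]; ring
    exact_mod_cast this
  have eY : p * b ^ 2 = (a * d - b * c) * Y := by
    have : ((p * b ^ 2 : ℤ) : ℝ) = ((a * d - b * c : ℤ) : ℝ) * Y := by
      rw [hD, ← hY]; push_cast; rw [← h2]; ring
    exact_mod_cast this
  have hp' := Nat.prime_iff_prime_int.1 hp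
  rcases det_eq_one_or_prime hp hDpos eX eW eZ eY hprim with hD1 | hDp
  · left
    rw [hD1, Int.cast_one] at hD
    have hs1 : s = 1 := by nlinarith
    rw [hs1, one_mul] at h1 h2 h3 h4
    obtain ⟨c', rfl⟩ : (p : ℤ) ∣ c := hp'.dvd_of_dvd_pow (n := 2)
      (by rw [eZ]; exact (dvd_mul_right _ _).mul_left _)
    exact mem_gamma0Real_iff.2 ⟨a, b, c', d, h1, h2, by rw [h3]; push_cast; rfl, h4⟩
  · right
    rw [hDp] at hD eX eW eZ
    push_cast at hD
    have hs1 : √(p : ℝ) = s := by rw [hD, Real.sqrt_sq hs.le]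
    obtain ⟨a', rfl⟩ : (p : ℤ) ∣ a := hp'.dvd_of_dvd_pow (n := 2) (eX ▸ dvd_mul_right _ _)
    obtain ⟨c', rfl⟩ : (p : ℤ) ∣ c := hp'.dvd_of_dvd_pow (n := 2) (eZ ▸ dvd_mul_right _ _)
    obtain ⟨d', rfl⟩ : (p : ℤ) ∣ d := hp'.dvd_of_dvd_pow (n := 2) (eW ▸ dvd_mul_right _ _)
    push_cast at h1 h3 h4
    rw [hD] at h1 h3 h4
    have g1 : N 0 0 = s * a' := mul_left_cancel₀ hs.ne' (by rw [h1]; ring)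
    have g3 : N 1 0 = s * c' := mul_left_cancel₀ hs.ne' (by rw [h3]; ring)
    have g4 : N 1 1 = s * d' := mul_left_cancel₀ hs.ne' (by rw [h4]; ring)
    refine mem_gamma0Real_iff.2 ⟨c', d', -a', -b, ?_, ?_, ?_, ?_⟩
    · simp [frickeTwist, hs1, g3, hs.ne']
    · simp [frickeTwist, hs1, g4, hs.ne']
    · simp [frickeTwist, hs1, g1]
      field_simp
    · simp [frickeTwist, ← h2, hD]
      field_simp
      rw [Real.sqrt_sq hs.le]

/-! ### Fractions and triangles -/

lemma frac_neg (n d : ℤ) : frac (-n) (-d) = frac n d := by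
  unfold frac
  by_cases hd : d = 0
  · simp [hd]
  · rw [if_neg hd, if_neg (neg_ne_zero.2 hd)]
    push_cast
    rw [neg_div_neg_eq]

lemma frac_num_den (v : OnePoint ℚ) : frac (num v) (den v) = v := by
  induction v using OnePoint.rec with
  | infty => rfl
  | coe q =>
    change frac q.num q.den = _
    rw [frac, if_neg (by exact_mod_cast q.den_ne_zero), Int.cast_natCast, Rat.num_div_den]

lemma num_den_frac_of_pos {n d : ℤ} (h : IsCoprime n d) (hd : 0 < d) :
    num (frac n d) = n ∧ den (frac n d) = d := by
  have hc : n.natAbs.Coprime d.natAbs := Int.isCoprime_iff_nat_coprime.1 h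
  rw [frac, if_neg hd.ne']
  exact ⟨Rat.num_div_eq_of_coprime hd hc, Rat.den_div_eq_of_coprime hd hc⟩

/-- This allows computing with matrix columns in place of lowest terms, at the cost of a sign for
each vertex. -/
lemma exists_sign_num_den_frac {n d : ℤ} (h : IsCoprime n d) :
    ∃ ε : ℤ, (ε = 1 ∨ ε = -1) ∧ num (frac n d) = ε * n ∧ den (frac n d) = ε * d := by
  rcases lt_trichotomy d 0 with hd | rfl | hd
  · obtain ⟨h1, h2⟩ := num_den_frac_of_pos h.neg_neg (neg_pos.2 hd)
    rw [frac_neg] at h1 h2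
    exact ⟨-1, Or.inr rfl, by linarith, by linarith⟩
  · have hn : n = 1 ∨ n = -1 := Int.isUnit_iff.1 (isCoprime_zero_right.1 h)
    refine ⟨n, hn, ?_, ?_⟩
    · change 1 = n * n
      rcases hn with rfl | rfl <;> rfl
    · exact (mul_zero n).symm
  · obtain ⟨h1, h2⟩ := num_den_frac_of_pos h hd
    exact ⟨1, Or.inl rfl, by linarith, by linarith⟩

lemma eq_sign_mul_of_frac_eq {n d n' d' : ℤ} (h : IsCoprime n d) (h' : IsCoprime n' d')
    (he : frac n d = frac n' d') : ∃ ε : ℤ, (ε = 1 ∨ ε = -1) ∧ n = ε * n' ∧ d = ε * d' := by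
  obtain ⟨ε, hε, h1, h2⟩ := exists_sign_num_den_frac h
  obtain ⟨δ, hδ, h3, h4⟩ := exists_sign_num_den_frac h'
  rw [he, h3] at h1
  rw [he, h4] at h2
  rcases hε with rfl | rfl <;> rcases hδ with rfl | rfl
  · exact ⟨1, Or.inl rfl, by linarith, by linarith⟩
  · exact ⟨-1, Or.inr rfl, by linarith, by linarith⟩
  · exact ⟨-1, Or.inr rfl, by linarith, by linarith⟩
  · exact ⟨1, Or.inl rfl, by linarith, by linarith⟩

section Triangles

variable {a b c d : ℤ}

lemma isCoprime_left_column (h : a * d - b * c = 1) : IsCoprime a c :=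
  ⟨d, -b, by linarith⟩

lemma isCoprime_right_column (h : a * d - b * c = 1) : IsCoprime b d :=
  ⟨-c, a, by linarith⟩

lemma farey_adj_frac (h : a * d - b * c = 1) : farey.Adj (frac a c) (frac b d) := by
  obtain ⟨ε, hε, h1, h2⟩ := exists_sign_num_den_frac (isCoprime_left_column h)
  obtain ⟨δ, hδ, h3, h4⟩ := exists_sign_num_den_frac (isCoprime_right_column h)
  change vdet _ _ = 1 ∨ vdet _ _ = -1
  rw [vdet, h1, h2, h3, h4]
  rcases hε with rfl | rfl <;> rcases hδ with rfl | rfl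
  · left; linarith
  · right; linarith
  · right; linarith
  · left; linarith

/-- The triangle to the left of the edge from `a/c` to `b/d` has the mediant as third vertex. -/
lemma ccwTriangle_frac_iff (h : a * d - b * c = 1) (w : OnePoint ℚ) :
    CcwTriangle (frac a c) (frac b d) w ↔ w = frac (b + a) (d + c) := by
  obtain ⟨ε, hε, h1, h2⟩ := exists_sign_num_den_frac (isCoprime_left_column h)
  obtain ⟨δ, hδ, h3, h4⟩ := exists_sign_num_den_frac (isCoprime_right_column h)
  constructor
  · rintro ⟨-, hvw, hwu, hpos⟩
    change vdet _ _ = 1 ∨ vdet _ _ = -1 at hvw hwu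
    rw [← frac_num_den w]
    simp only [vdet, h1, h2, h3, h4] at hvw hwu hpos
    generalize num w = x at *
    generalize den w = y at *
    have hP : (b * y - x * d = 1 ∨ b * y - x * d = -1) := by
      rcases hδ with rfl | rfl <;> rcases hvw with e | e
      · left; linarith
      · right; linarith
      · right; linarith
      · left; linarith
    have hQ : (x * c - a * y = 1 ∨ x * c - a * y = -1) := by
      rcases hε with rfl | rfl <;> rcases hwu with e | e
      · left; linarith
      · right; linarith
      · right; linarith
      · left; linarith
    have hεε : ε * ε = 1 := by rcases hε with rfl | rfl <;> rfl
    have hδδ : δ * δ = 1 := by rcases hδ with rfl | rfl <;> rfl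
    have hPQ : 0 < (b * y - x * d) * (x * c - a * y) := by
      have : (ε * a * (δ * d) - δ * b * (ε * c)) * (δ * b * y - x * (δ * d)) *
          (x * (ε * c) - ε * a * y) = (ε * ε) * (δ * δ) * (a * d - b * c) *
            ((b * y - x * d) * (x * c - a * y)) := by ring
      rwa [this, hεε, hδδ, h, one_mul, one_mul, one_mul] at hpos
    -- Cramer's rule in the basis `(a, c)`, `(b, d)`. Both coefficients are `±1`, and the
    -- orientation makes them equal.
    have hx : x = -(a * (b * y - x * d)) - b * (x * c - a * y) := by
      linear_combination (-x) * h
    have hy : y = -(c * (b * y - x * d)) - d * (x * c - a * y) := by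
      linear_combination (-y) * h
    rcases hP with e | e <;> rcases hQ with f | f <;> rw [e, f] at hPQ hx hy <;>
      norm_num at hPQ
    · rw [hx, hy, ← frac_neg]
      ring_nf
    · rw [hx, hy]
      ring_nf
  · rintro rfl
    have g1 : a * (d + c) - (b + a) * c = 1 := by linarith
    have g2 : (b + a) * d - b * (d + c) = 1 := by linarith
    have hpos : 0 < vdet (frac a c) (frac b d) * vdet (frac b d) (frac (b + a) (d + c)) *
        vdet (frac (b + a) (d + c)) (frac a c) := by
      obtain ⟨η, hη, h5, h6⟩ := exists_sign_num_den_frac (isCoprime_right_column g1)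
      have hεε : ε * ε = 1 := by rcases hε with rfl | rfl <;> rfl
      have hδδ : δ * δ = 1 := by rcases hδ with rfl | rfl <;> rfl
      have hηη : η * η = 1 := by rcases hη with rfl | rfl <;> rfl
      simp only [vdet, h1, h2, h3, h4, h5, h6]
      have : (ε * a * (δ * d) - δ * b * (ε * c)) *
          (δ * b * (η * (d + c)) - η * (b + a) * (δ * d)) *
          (η * (b + a) * (ε * c) - ε * a * (η * (d + c))) =
          (ε * ε) * (δ * δ) * (η * η) * (a * d - b * c) * ((b + a) * d - b * (d + c)) *
            (a * (d + c) - (b + a) * c) := by ring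
      rw [this, hεε, hδδ, hηη, h, g1, g2]
      norm_num
    exact ⟨farey_adj_frac h, (farey_adj_frac g2).symm, (farey_adj_frac g1).symm, hpos⟩

lemma CcwTriangle.rotate {u v w : OnePoint ℚ} (h : CcwTriangle u v w) : CcwTriangle v w u :=
  ⟨h.2.1, h.2.2.1, h.1, by
    have := h.2.2.2
    rwa [mul_assoc, mul_comm] at this⟩

/-- After rotation this is the triangle to the left of the edge from `b/d` to `a/c`, whose matrix
has columns `(b, d)` and `(-a, -c)`. -/
lemma ccwTriangle_frac_iff' (h : a * d - b * c = 1) (w : OnePoint ℚ) :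
    CcwTriangle (frac a c) w (frac b d) ↔ w = frac (b - a) (d - c) := by
  have h' : b * -c - -a * d = 1 := by linarith
  have := ccwTriangle_frac_iff h' w
  rw [frac_neg, show -a + b = b - a by ring, show -c + d = d - c by ring] at this
  rw [← this]
  exact ⟨fun h => h.rotate.rotate, fun h => h.rotate⟩

/-- Each triangle crossed to the left adds the first column to the second, and each one to the right
subtracts it. -/
lemma turn_frac_iff (h : a * d - b * c = 1) (w : OnePoint ℚ) (n : ℤ) :
    Turn (frac a c) (frac b d) w n ↔ w = frac (a * n + b) (c * n + d) := by
  have hdet : ∀ n : ℤ, a * (c * n + d) - (a * n + b) * c = 1 := fun n => by linarith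
  constructor
  · intro ht
    induction ht with
    | refl => simp
    | @left w w' n _ ht ih =>
      rw [ih, ccwTriangle_frac_iff (hdet n)] at ht
      rw [ht]
      ring_nf
    | @right w w' n _ ht ih =>
      rw [ih, ccwTriangle_frac_iff' (hdet n)] at ht
      rw [ht]
      ring_nf
  · rintro rfl
    induction n using Int.induction_on with
    | zero => simpa using Turn.refl (farey_adj_frac h)
    | succ n ih =>
      refine ih.left ?_
      rw [ccwTriangle_frac_iff (hdet n)]
      ring_nf
    | pred n ih =>
      refine ih.right ?_
      rw [ccwTriangle_frac_iff' (hdet (-n))]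
      ring_nf

end Triangles

/-! ### Edge paths and matrices -/

/-- The matrix of the `j`-th edge (counted from `0`) of the edge path with turns `a`: the edge goes
from the fraction of the second column to that of the first one. -/
def edgeMat (a : ℕ → ℤ) : ℕ → SL(2, ℤ)
  | 0 => S
  | j + 1 => edgeMat a j * T ^ a j * S

lemma coe_mul_T_zpow_mul_S (A : SL(2, ℤ)) (n : ℤ) :
    ((A * T ^ n * S : SL(2, ℤ)) : Matrix (Fin 2) (Fin 2) ℤ) =
      !![A 0 0 * n + A 0 1, -A 0 0; A 1 0 * n + A 1 1, -A 1 0] := by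
  rw [coe_mul_S, coe_mul_T_zpow]
  rfl

lemma coe_edgeMat_succ (a : ℕ → ℤ) (j : ℕ) :
    (edgeMat a (j + 1) : Matrix (Fin 2) (Fin 2) ℤ) =
      !![edgeMat a j 0 0 * a j + edgeMat a j 0 1, -edgeMat a j 0 0;
        edgeMat a j 1 0 * a j + edgeMat a j 1 1, -edgeMat a j 1 0] :=
  coe_mul_T_zpow_mul_S _ _

lemma edgeMat_congr {a b : ℕ → ℤ} {j : ℕ} (h : ∀ i < j, a i = b i) :
    edgeMat a j = edgeMat b j := by
  induction j with
  | zero => rfl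
  | succ j ih => rw [edgeMat, edgeMat, ih fun i hi => h i (by omega), h j (by omega)]

lemma rademacher_edgeMat (a : ℕ → ℤ) (k : ℕ) :
    rademacher (edgeMat a k) = ((∑ j ∈ Finset.range k, a j : ℤ) : ℚ) -
      3 * ((∑ j ∈ Finset.range k, (edgeMat a j 1 0 * edgeMat a (j + 1) 1 0).sign : ℤ) : ℚ) := by
  induction k with
  | zero => simp [edgeMat, rademacher_S]
  | succ k ih =>
    rw [Finset.sum_range_succ, Finset.sum_range_succ, edgeMat, rademacher_mul_S,
      rademacher_mul_T_zpow, ih, coe_mul_T_zpow, coe_mul_T_zpow_mul_S]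
    simp only [Matrix.of_apply, Matrix.cons_val', Matrix.cons_val_zero,
      Matrix.cons_val_one, Matrix.cons_val_fin_one]
    push_cast
    ring

lemma sign_intCast_real (m : ℤ) : (SignType.sign (m : ℝ) : ℤ) = m.sign := by
  rcases lt_trichotomy m 0 with h | rfl | h
  · rw [sign_neg (by exact_mod_cast h), Int.sign_eq_neg_one_of_neg h]; rfl
  · simp
  · rw [sign_pos (by exact_mod_cast h), Int.sign_eq_one_of_pos h]; rfl

lemma signWalk_eq_sum_sign (a : ℕ → ℤ) (k : ℕ) :
    signWalk k (fun i => (a i : ℝ)) 1 0 =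
      ∑ j ∈ Finset.range k, (edgeMat a j 1 0 * edgeMat a (j + 1) 1 0).sign := by
  have h1 : ∀ j, -edgeMat a (j + 1) 1 1 = edgeMat a j 1 0 := fun j => by
    rw [coe_edgeMat_succ]
    simp
  -- Since `d_{j+1} = -c_j`, the sequence `-d_j` is `c_j` delayed by one place, with the initial `0`
  -- that the walk needs.
  have h2 := signWalk_eq_sum (fun j => ((-edgeMat a j 1 1 : ℤ) : ℝ)) (fun i => (a i : ℝ))
    (fun j => by
      rw [h1, h1, coe_edgeMat_succ]
      simp only [Matrix.of_apply, Matrix.cons_val', Matrix.cons_val_zero,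
        Matrix.cons_val_one, Matrix.cons_val_fin_one]
      push_cast
      ring) k
  simp only [h1, ← Int.cast_mul, sign_intCast_real] at h2
  rw [← h2]
  simp [edgeMat, ModularGroup.coe_S]

namespace BasedEdgePath

/-- The turns of a path, continued by zeros. -/
def turnSeq (α : BasedEdgePath) (j : ℕ) : ℤ := if h : j < α.k then α.turn ⟨j, h⟩ else 0

lemma turnSeq_coe (α : BasedEdgePath) (j : Fin α.k) : α.turnSeq j = α.turn j := by
  simp [turnSeq]

lemma vertex_eq_frac (α : BasedEdgePath) (j : ℕ) (hj : j ≤ α.k) :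
    α.vertex ⟨j, by omega⟩ = frac (edgeMat α.turnSeq j 0 1) (edgeMat α.turnSeq j 1 1) ∧
      α.vertex ⟨j + 1, by omega⟩ =
        frac (edgeMat α.turnSeq j 0 0) (edgeMat α.turnSeq j 1 0) := by
  induction j with
  | zero =>
    refine ⟨α.start_infty.trans ?_, α.start_zero.trans ?_⟩ <;>
      simp [edgeMat, ModularGroup.coe_S, frac]
  | succ j ih =>
    obtain ⟨h1, h2⟩ := ih (by omega)
    rw [coe_edgeMat_succ]
    simp only [Matrix.of_apply, Matrix.cons_val', Matrix.cons_val_zero,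
      Matrix.cons_val_one, Matrix.cons_val_fin_one, frac_neg]
    refine ⟨h2, ?_⟩
    have ht := α.turn_spec ⟨j, hj⟩
    rw [← turnSeq_coe] at ht
    change Turn (α.vertex ⟨j + 1, by omega⟩) (α.vertex ⟨j, by omega⟩)
      (α.vertex ⟨j + 1 + 1, by omega⟩) (α.turnSeq j) at ht
    rw [h1, h2, turn_frac_iff (det_entries _)] at ht
    exact ht

/-- The end vertices fix each column up to sign, and determinant `1` forces the two signs to agree.
-/
lemma MadeFrom.eq_or_eq_neg {α : BasedEdgePath} {A : SL(2, ℤ)} (h : α.MadeFrom A) :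
    A = edgeMat α.turnSeq α.k ∨ A = -edgeMat α.turnSeq α.k := by
  obtain ⟨h1, h2⟩ := h
  obtain ⟨h3, h4⟩ := α.vertex_eq_frac α.k le_rfl
  set B := edgeMat α.turnSeq α.k
  have hA := det_entries A
  have hB := det_entries B
  obtain ⟨ε, hε, e1, e2⟩ := eq_sign_mul_of_frac_eq (isCoprime_left_column hA)
    (isCoprime_left_column hB) (h2.symm.trans h4)
  obtain ⟨δ, hδ, e3, e4⟩ := eq_sign_mul_of_frac_eq (isCoprime_right_column hA)
    (isCoprime_right_column hB) (h1.symm.trans h3)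
  have hεδ : ε * δ = 1 := by
    rw [e1, e2, e3, e4] at hA
    linear_combination hA - ε * δ * hB
  rcases hε with rfl | rfl
  · left
    obtain rfl : δ = 1 := by linarith
    ext i j
    fin_cases i <;> fin_cases j <;> simp [e1, e2, e3, e4]
  · right
    obtain rfl : δ = -1 := by linarith
    ext i j
    fin_cases i <;> fin_cases j <;> simp [e1, e2, e3, e4]

lemma trace_eq_sum (α : BasedEdgePath) : α.trace = ∑ j ∈ Finset.range α.k, α.turnSeq j := by
  rw [← Fin.sum_univ_eq_sum_range]
  simp [trace, Matrix.trace, mat, turnSeq_coe]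

lemma signature_eq_signWalk (α : BasedEdgePath) :
    α.signature = signWalk α.k (fun i => (α.turnSeq i : ℝ)) 1 0 := by
  have : α.mat.map (Int.cast : ℤ → ℝ) = tridiag α.k fun i => (α.turnSeq i : ℝ) := by
    ext i j
    simp only [mat, tridiag, Matrix.map_apply, Matrix.of_apply, turnSeq_coe]
    split_ifs <;> simp
  rw [← sig_tridiag, signature, this]

theorem MadeFrom.rademacher_eq {α : BasedEdgePath} {A : SL(2, ℤ)} (h : α.MadeFrom A) :
    rademacher A = (α.trace : ℚ) - 3 * (α.signature : ℚ) := by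
  have hA : rademacher A = rademacher (edgeMat α.turnSeq α.k) := by
    rcases h.eq_or_eq_neg with h | h <;> rw [h]
    exact rademacher_neg _
  rw [hA, rademacher_edgeMat, trace_eq_sum, signature_eq_signWalk, signWalk_eq_sum_sign]

/-- The edge path with given turns. -/
def ofTurns (a : ℕ → ℤ) (k : ℕ) : BasedEdgePath where
  k := k
  -- Every vertex is listed as the tail of an edge. The final head is the tail of edge `k + 1`,
  -- whose second column does not involve `a k`.
  vertex i := frac (edgeMat a i 0 1) (edgeMat a i 1 1)
  start_infty := by simp [edgeMat, ModularGroup.coe_S, frac]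
  start_zero := by
    change frac (edgeMat a 1 0 1) (edgeMat a 1 1 1) = _
    rw [coe_edgeMat_succ]
    simp [edgeMat, ModularGroup.coe_S, frac]
  adj i := by
    have h := (farey_adj_frac (det_entries (edgeMat a i))).symm
    rw [← frac_neg (edgeMat a i 0 0)] at h
    simpa [coe_edgeMat_succ] using h
  turn j := a j
  turn_spec j := by
    have h := (turn_frac_iff (det_entries (edgeMat a j)) _ (a j)).2 rfl
    rw [← frac_neg (edgeMat a j 0 0), ← frac_neg (_ * _ + _)] at h
    simpa [coe_edgeMat_succ] using h

lemma ofTurns_madeFrom (a : ℕ → ℤ) (k : ℕ) : (ofTurns a k).MadeFrom (edgeMat a k) := by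
  refine ⟨rfl, ?_⟩
  change frac (edgeMat a (k + 1) 0 1) (edgeMat a (k + 1) 1 1) = _
  rw [coe_edgeMat_succ, ← frac_neg (edgeMat a k 0 0)]
  rfl

lemma MadeFrom.neg {α : BasedEdgePath} {A : SL(2, ℤ)} (h : α.MadeFrom A) : α.MadeFrom (-A) := by
  simpa [MadeFrom, frac_neg] using h

lemma exists_madeFrom_mul_T_zpow_mul_S {A : SL(2, ℤ)} (h : ∃ α : BasedEdgePath, α.MadeFrom A)
    (n : ℤ) : ∃ α : BasedEdgePath, α.MadeFrom (A * T ^ n * S) := by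
  obtain ⟨α, hα⟩ := h
  have he : edgeMat (Function.update α.turnSeq α.k n) (α.k + 1) =
      edgeMat α.turnSeq α.k * T ^ n * S := by
    rw [edgeMat, Function.update_self, edgeMat_congr (b := α.turnSeq)]
    intro i hi
    rw [Function.update_of_ne hi.ne]
  have hm := ofTurns_madeFrom (Function.update α.turnSeq α.k n) (α.k + 1)
  rw [he] at hm
  rcases hα.eq_or_eq_neg with h | h
  · exact ⟨_, h ▸ hm⟩
  · exact ⟨_, by rw [h, neg_mul, neg_mul]; exact hm.neg⟩

lemma S_mul_S : S * S = (-1 : SL(2, ℤ)) := by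
  ext i j
  fin_cases i <;> fin_cases j <;> simp [ModularGroup.coe_S]

/-- The matrices with a path are closed under sign change and under appending `T ^ n * S`. A zero
turn appends `S` alone, and as `S * S = -1`, the turns `n, 0` append `T ^ n` up to sign. -/
theorem exists_madeFrom (A : SL(2, ℤ)) : ∃ α : BasedEdgePath, α.MadeFrom A := by
  have hneg : ∀ A : SL(2, ℤ), (∃ α : BasedEdgePath, α.MadeFrom (-A)) →
      ∃ α : BasedEdgePath, α.MadeFrom A := by
    rintro A ⟨α, hα⟩
    exact ⟨α, by simpa using hα.neg⟩
  have hS : ∀ A : SL(2, ℤ), (∃ α : BasedEdgePath, α.MadeFrom A) →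
      ∃ α : BasedEdgePath, α.MadeFrom (A * S) := fun A h => by
    simpa using exists_madeFrom_mul_T_zpow_mul_S h 0
  have hT : ∀ (A : SL(2, ℤ)) (n : ℤ), (∃ α : BasedEdgePath, α.MadeFrom A) →
      ∃ α : BasedEdgePath, α.MadeFrom (A * T ^ n) := fun A n h => by
    have h1 := hS _ (exists_madeFrom_mul_T_zpow_mul_S h n)
    rw [mul_assoc, S_mul_S, mul_neg, mul_one] at h1
    exact hneg _ h1
  have hmem : A ∈ Subgroup.closure {S, T} := by
    rw [SpecialLinearGroup.SL2Z_generators]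
    trivial
  induction hmem using Subgroup.closure_induction_right with
  | one =>
    refine hneg _ ?_
    rw [← S_mul_S]
    exact hS _ ⟨ofTurns 0 0, ofTurns_madeFrom 0 0⟩
  | mul_right A _ B hB ih =>
    rcases hB with rfl | rfl
    · exact hS A ih
    · simpa using hT A 1 ih
  | mul_inv_cancel A _ B hB ih =>
    rcases hB with rfl | rfl
    · have : (S : SL(2, ℤ))⁻¹ = -S := by
        rw [inv_eq_iff_mul_eq_one, mul_neg, S_mul_S, neg_neg]
      rw [this, mul_neg]
      exact hneg _ (by rw [neg_neg]; exact hS A ih)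
    · simpa using hT A (-1) ih

end BasedEdgePath

/-! ### The Rademacher symbol of `Γ₀⁺(p)` -/

lemma toReal_injective : Function.Injective toReal := by
  intro g h hgh
  ext i j
  have : ((g i j : ℤ) : ℝ) = h i j := by rw [← toReal_apply, ← toReal_apply, hgh]
  exact_mod_cast this

lemma mem_gamma0Real_iff_exists {p : ℕ} {γ : SL(2, ℝ)} :
    γ ∈ gamma0Real p ↔ ∃ g : CongruenceSubgroup.Gamma0 p, toReal g.1 = γ :=
  ⟨fun ⟨g, hg, h⟩ => ⟨⟨g, hg⟩, h⟩, fun ⟨g, h⟩ => ⟨g.1, g.2, h⟩⟩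

/-- Injectivity of `toReal` makes the choice in `rademacherP` harmless. -/
lemma choose_eq_of_toReal_eq {p : ℕ} {γ : SL(2, ℝ)} {g : CongruenceSubgroup.Gamma0 p}
    (hg : toReal g.1 = γ) (h : ∃ g : CongruenceSubgroup.Gamma0 p, toReal g.1 = γ) :
    h.choose = g :=
  Subtype.ext (toReal_injective (h.choose_spec.trans hg.symm))

lemma rademacherP_of_toReal_eq {p : ℕ} [NeZero p] {γ : SL(2, ℝ)}
    {g : CongruenceSubgroup.Gamma0 p} (hg : toReal g.1 = γ) :
    rademacherP p γ = rademacherAvg p g := by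
  have h : ∃ g : CongruenceSubgroup.Gamma0 p, toReal g.1 = γ := ⟨g, hg⟩
  rw [rademacherP, dif_pos h, choose_eq_of_toReal_eq hg h]

lemma rademacherP_of_frickeTwist {p : ℕ} [NeZero p] {γ : SL(2, ℝ)} (hγ : γ ∉ gamma0Real p)
    (hW : frickeTwist p γ ∈ gamma0Real p) :
    rademacherP p γ = rademacherP p (frickeTwist p γ)
      - 3 * ((SignType.sign (-(γ 0 0 * γ 1 0)) : ℤ) : ℚ) := by
  rw [mem_gamma0Real_iff_exists] at hγ hW
  obtain ⟨g, hg⟩ := id hW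
  rw [rademacherP_of_toReal_eq hg, rademacherP, dif_neg hγ, dif_pos hW,
    choose_eq_of_toReal_eq hg hW]

end FareyRademacher
end

theorem theorem2 (p : ℕ) [Fact p.Prime] (hp : Odd p) (γ : SL(2, ℝ)) (hγ : γ ∈ gamma0Plus p) :
    (∀ g : CongruenceSubgroup.Gamma0 p, toReal g.1 = γ →
      (∃ α : BasedEdgePath, α.MadeFrom g.1) ∧
      (∃ β : BasedEdgePath, β.MadeFrom (conjMul p g)) ∧
      ∀ α β : BasedEdgePath, α.MadeFrom g.1 → β.MadeFrom (conjMul p g) →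
        rademacherP p γ =
          ((α.trace : ℚ) + (β.trace : ℚ)) / 2
            - 3 * (((α.signature : ℚ) + (β.signature : ℚ)) / 2)) ∧
    (γ ∉ gamma0Real p →
      frickeTwist p γ ∈ gamma0Real p ∧
      rademacherP p γ =
        rademacherP p (frickeTwist p γ)
          - 3 * ((SignType.sign (-(γ 0 0 * γ 1 0)) : ℤ) : ℚ)) := by
  refine ⟨fun g hg => ⟨BasedEdgePath.exists_madeFrom _, BasedEdgePath.exists_madeFrom _,
    fun α β hα hβ => ?_⟩, fun hn => ?_⟩
  · rw [rademacherP_of_toReal_eq hg, rademacherAvg, hα.rademacher_eq, hβ.rademacher_eq]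
    ring
  · have hW := (mem_gamma0Real_or_frickeTwist_mem Fact.out hγ).resolve_left hn
    exact ⟨hW, rademacherP_of_frickeTwist hn hW⟩
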